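/- Let $T>0$, $A,\rho\in\mathbb R$ and $\sigma>0$, $\sigma\neq 1$. Assume $AT>1$, let $\xi$ be the (unique) strictly positive root of $z=A(1-e^{-zT})$, and assume $\rho>\xi(1-\sigma)$ and $\frac{\rho-\xi(1-\sigma)}{\sigma}<A$. Delay problem. Given $\bar\iota\in L^2(-T,0)$ and $i:[0,\infty)\to\mathbb R$, let $k$ solve $k'(t)=i(t)-i(t-T)$ for $t\ge0$, $i=\bar\iota$ on $[-T,0)$, $k(0)=\int_{-T}^0\bar\iota(s)\,ds$. Over the set of all $i\in L^2_{\rm loc}([0,\infty))$ with $i(t)\in[0,Ak(t)]$ for all $t\ge0$, maximize $$J(\bar\iota;i)=\int_0^\infty e^{-\rho t}\frac{(Ak(t)-i(t))^{1-\sigma}}{1-\sigma}\,dt\in[-\infty,+\infty].$$ Write $V$ for the supremum. Hilbert space setting. Let $X=\mathbb R\times L^2(-T,0)$, $D(\mathcal A)=\{(\psi^0,\psi^1)\in X:\psi^1\in W^{1,2}(-T,0),\ \psi^0=\psi^1(0)\}$, $\mathcal A(\psi^0,\psi^1)=(0,\tfrac{d}{ds}\psi^1)$, $B(\psi^0,\psi^1)=\psi^1(0)-\psi^1(-T)$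 on $D(\mathcal A)$, and $F(z)(s)=-z(-T-s)$ for $z\in L^2(-T,0)$. Put $$\Gamma_0(x)=x^0+\int_{-T}^0e^{\xi s}x^1(s)\,ds,\qquad \nu=\Big(\frac{\rho-\xi(1-\sigma)}{\sigma}\Big)^{-\sigma}\Big(\frac A\xi\Big)^{1-\sigma},$$ $$\phi(x)=Ax^0-\nu^{-1/\sigma}\Big(\frac A\xi\Big)^{1/\sigma}\Gamma_0(x),\qquad \mathcal O=\{x\in X:\Gamma_0(x)>0,\ \phi(x)>0\},\qquad v(x)=\nu\,\frac{\Gamma_0(x)^{1-\sigma}}{1-\sigma}\ \text{ on } \mathcal O.$$ Theorem. Let $\bar\iota\in L^2(-T,0)$ with $\bar\iota\ge0$ a.e., let $k_0=\int_{-T}^0\bar\iota(s)\,ds>0$, and let $x=(k_0,F(\bar\iota))$. Then the closed-loop equation $$y'(t)=\mathcal A^*y(t)+B^*\phi(y(t)),\qquad y(0)=x,$$ has a unique solution $y\in C([0,\infty);X)$, where the equation is understood in $D(\mathcal A)'$, i.e. $\langle y(t),\psi\rangle=\langle x,\psi\rangle+\int_0^t\big(\langle y(s),\mathcal A\psi\rangle+\phi(y(s))\,B\psi\big)ds$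 for all $\psi\in D(\mathcal A)$ and $t\ge0$. For all $t\ge0$ one has $y(t)\in\mathcal O$, $y^0(t)>0$ and $\phi(y(t))>0$. The control $i^*(t)=\phi(y(t))$ is admissible and optimal for the delay problem with datum $\bar\iota$, and the value of that problem is $V=v(x)$. -/

import Mathlib

open MeasureTheory Set
open scoped ENNReal

namespace VintageCapital

noncomputable section

/-- Lebesgue measure on the history interval `(-T, 0)`. -/
abbrev histMeasure (T : ℝ) : Measure ℝ := volume.restrict (Ioo (-T) 0)

/-- The space `L²(-T, 0; ℝ)`. -/
abbrev L2Hist (T : ℝ) : Type := Lp ℝ 2 (histMeasure T)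

/-- The Hilbert space `X = ℝ × L²(-T, 0; ℝ)` with the product inner product. -/
abbrev StateSpace (T : ℝ) : Type := WithLp 2 (ℝ × L2Hist T)

theorem measurePreserving_reflect (T : ℝ) :
    MeasurePreserving (fun s : ℝ => -T - s) (histMeasure T) (histMeasure T) := by
  have h : MeasurePreserving (fun s : ℝ => -T - s) volume volume :=
    Measure.measurePreserving_sub_left volume (-T)
  have h2 := h.restrict_preimage (s := Ioo (-T) 0) measurableSet_Ioo
  have h3 : (fun s : ℝ => -T - s) ⁻¹' (Ioo (-T) 0) = Ioo (-T) 0 := by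
    ext s
    simp only [mem_preimage, mem_Ioo]
    constructor <;> rintro ⟨h1, h2⟩ <;> constructor <;> linarith
  rwa [h3] at h2

/-- The operator `F` on `L²(-T, 0)`, `F(z)(s) = -z(-T - s)`. -/
def histF (T : ℝ) (z : L2Hist T) : L2Hist T :=
  -(Lp.compMeasurePreserving (fun s : ℝ => -T - s) (measurePreserving_reflect T) z)

/-- An element of the domain `D(𝒜) = {(ψ⁰, ψ¹) ∈ X : ψ¹ ∈ W^{1,2}(-T, 0), ψ⁰ = ψ¹(0)}`, given
together with the absolutely continuous representative `rep` of `ψ¹` on `[-T, 0]` and its weak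
derivative `der ∈ L²(-T, 0)`. -/
structure DomA (T : ℝ) where
  /-- the pair `(ψ⁰, ψ¹)` -/
  val : StateSpace T
  /-- the representative of `ψ¹` (only its values on `[-T, 0]` matter) -/
  rep : ℝ → ℝ
  /-- the derivative of `ψ¹` -/
  der : L2Hist T
  snd_ae_eq : (val.snd : ℝ → ℝ) =ᵐ[histMeasure T] rep
  rep_eq : ∀ s ∈ Icc (-T) 0, rep s = rep 0 - ∫ r in s..0, der r
  fst_eq : val.fst = rep 0

/-- The operator `𝒜(ψ⁰, ψ¹) = (0, dψ¹/ds)` on `D(𝒜)`. -/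
def DomA.opA {T : ℝ} (ψ : DomA T) : StateSpace T := WithLp.toLp 2 (0, ψ.der)

/-- The operator `B(ψ⁰, ψ¹) = ψ¹(0) - ψ¹(-T)` on `D(𝒜)`. -/
def DomA.opB {T : ℝ} (ψ : DomA T) : ℝ := ψ.rep 0 - ψ.rep (-T)

/-- The adjoint `𝒜^* : X → D(𝒜)'`, as a functional on `D(𝒜)`. -/
def adjA {T : ℝ} (x : StateSpace T) (ψ : DomA T) : ℝ := inner ℝ x ψ.opA

/-- The adjoint `B^* : ℝ → D(𝒜)'`, as a functional on `D(𝒜)`. -/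
def adjB {T : ℝ} (u : ℝ) (ψ : DomA T) : ℝ := u * ψ.opB

/-- `y ∈ C([0,∞); X)` solves the closed-loop equation `y' = 𝒜^* y + B^* φ(y)`, `y(0) = x`, with
values in `D(𝒜)'`: the equation is tested against every `ψ ∈ D(𝒜)` and integrated in time. -/
def IsClosedLoopSolution {T : ℝ} (φ : StateSpace T → ℝ) (x : StateSpace T)
    (y : ℝ → StateSpace T) : Prop :=
  ContinuousOn y (Ici 0) ∧ y 0 = x ∧
    ∀ ψ : DomA T, ∀ t : ℝ, 0 ≤ t →
      inner ℝ (y t) ψ.val = inner ℝ x ψ.val + ∫ s in (0 : ℝ)..t, (adjA (y s) ψ + adjB (φ (y s)) ψ)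

/-- The equivalent capital `Γ₀(x) = x⁰ + ∫_{-T}^0 e^{ξ s} x¹(s) ds`. -/
def Gamma0 {T : ℝ} (ξ : ℝ) (x : StateSpace T) : ℝ :=
  x.fst + ∫ s in Ioo (-T) 0, Real.exp (ξ * s) * x.snd s

/-- The constant `ν = ((ρ - ξ(1-σ))/σ)^{-σ} (A/ξ)^{1-σ}`. -/
def nu (A σ ρ ξ : ℝ) : ℝ :=
  ((ρ - ξ * (1 - σ)) / σ) ^ (-σ) * (A / ξ) ^ (1 - σ)

/-- The set `𝒪`. -/
def setO (T A σ ρ ξ : ℝ) : Set (StateSpace T) :=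
  {x | 0 < Gamma0 ξ x ∧
    nu A σ ρ ξ ^ (-1 / σ) * (A / ξ) ^ (1 / σ) * Gamma0 ξ x < A * x.fst}

/-- The feedback map `φ(x) = i^*(x) = A x⁰ - ν^{-1/σ} (A/ξ)^{1/σ} Γ₀(x)`
(the formula makes sense on all of `X`). -/
def feedback {T : ℝ} (A σ ρ ξ : ℝ) (x : StateSpace T) : ℝ :=
  A * x.fst - nu A σ ρ ξ ^ (-1 / σ) * (A / ξ) ^ (1 / σ) * Gamma0 ξ x

/-- The function `v(x) = ν Γ₀(x)^{1-σ} / (1-σ)`. -/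
def candidateV {T : ℝ} (A σ ρ ξ : ℝ) (x : StateSpace T) : ℝ :=
  nu A σ ρ ξ * (Gamma0 ξ x ^ (1 - σ) / (1 - σ))

/-- The investment path on `[-T, ∞)`: the datum `ι` before time `0`, the control `i` afterwards. -/
def investment {T : ℝ} (ι : L2Hist T) (i : ℝ → ℝ) (s : ℝ) : ℝ := if s < 0 then ι s else i s

/-- The capital stock: the (Carathéodory) solution of `k'(t) = i(t) - i(t - T)`,
`k(0) = ∫_{-T}^0 ι`, with `i = ι` on `[-T, 0)`. -/
def capital {T : ℝ} (ι : L2Hist T) (i : ℝ → ℝ) (t : ℝ) : ℝ :=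
  (∫ s in Ioo (-T) 0, ι s) +
    ∫ s in (0 : ℝ)..t, (investment ι i s - investment ι i (s - T))

/-- The admissible controls: `i ∈ L²_loc([0, ∞))` with `i(t) ∈ [0, A k(t)]` for all `t ≥ 0`. -/
def admissible {T : ℝ} (A : ℝ) (ι : L2Hist T) : Set (ℝ → ℝ) :=
  {i | (∀ R : ℝ, MemLp i 2 (volume.restrict (Icc 0 R))) ∧
    ∀ t : ℝ, 0 ≤ t → i t ∈ Icc 0 (A * capital ι i t)}

/-- The functional `J(ι; i) = ∫_0^∞ e^{-ρ t} (A k(t) - i(t))^{1-σ} / (1-σ) dt` as an extended real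
number. The integrand has a constant sign on admissible controls; for `σ > 1` its value at zero
consumption is `-∞`, as the convention `0 ^ (1-σ) = ∞` in `[0, ∞]` provides. -/
def welfare {T : ℝ} (A σ ρ : ℝ) (ι : L2Hist T) (i : ℝ → ℝ) : EReal :=
  (((1 - σ)⁻¹ : ℝ) : EReal) *
    ((∫⁻ t in Ioi (0 : ℝ), ENNReal.ofReal (Real.exp (-ρ * t)) *
      ENNReal.ofReal (A * capital ι i t - i t) ^ (1 - σ) : ℝ≥0∞) : EReal)

/-- The value function of the delay problem. -/
def value {T : ℝ} (A σ ρ : ℝ) (ι : L2Hist T) : EReal :=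
  ⨆ i ∈ admissible A ι, welfare A σ ρ ι i

/-- Optimality of a control for the delay problem. -/
def IsOptimal {T : ℝ} (A σ ρ : ℝ) (ι : L2Hist T) (i : ℝ → ℝ) : Prop :=
  i ∈ admissible A ι ∧ ∀ j ∈ admissible A ι, welfare A σ ρ ι j ≤ welfare A σ ρ ι i

end

end VintageCapital

/-!
The equivalent capital `Γ₀` is the pairing of the state with `(1, e^{ξ s})`, and the equation for
`ξ` turns the state equation into `d/dt Γ₀(y(t)) = ξ Γ₀(y(t)) - (ξ / A) c(t)`, where
`c = A k - i` is the consumption. Since `Γ₀ ≥ 0` along nonnegative investments, every admissible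
control satisfies the budget constraint `∫ e^{-ξ t} c(t) dt ≤ (A / ξ) Γ₀(x)`. Under the feedback `φ`
consumption is a fixed multiple of `Γ₀`, so it is an exponential that exhausts the budget, and its
discounted marginal utility is proportional to the price `e^{-ξ t}`; concavity of the utility then
makes it optimal. Nonnegative past investment also gives `Γ₀(y) ≤ (ξ / A) y⁰`, hence
`φ(y) ≥ (1 - θ / A) A y⁰` with `θ = (ρ - ξ (1 - σ)) / σ < A`, so that `φ(y(t))` cannot reach zero.
Existence follows from the Volterra equation `A k(t) - i(t) = c(t)` with the exponential `c`
prescribed. For uniqueness, the difference of two solutions of the state equation with the same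
control is tested against smooth histories; this leaves only the same Volterra equation for `i`.
-/

namespace VintageCapital

open Filter Topology
open scoped BoundedContinuousFunction ContDiff

section IntegralEquations

theorem integral_mul_eq_sub_of_integral_eq {F G f g : ℝ → ℝ} {a b : ℝ}
    (hf : IntervalIntegrable f volume a b) (hg : IntervalIntegrable g volume a b)
    (hF : ∀ x ∈ uIcc a b, F x = F a + ∫ r in a..x, f r)
    (hG : ∀ x ∈ uIcc a b, G x = G a + ∫ r in a..x, g r) :
    ∫ x in a..b, F x * g x = F b * G b - F a * G a - ∫ x in a..b, f x * G x := by
  have primitive_ac {H h : ℝ → ℝ} (hh : IntervalIntegrable h volume a b) :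
      AbsolutelyContinuousOnInterval (fun x => H a + ∫ r in a..x, h r) a b :=
    (contDiffOn_const (𝕜 := ℝ) (n := 1)).absolutelyContinuousOnInterval.add
      (hh.absolutelyContinuousOnInterval_intervalIntegral left_mem_uIcc)
  have parts := (primitive_ac (H := F) hf).integral_mul_deriv_eq_deriv_mul
    (primitive_ac (H := G) hg)
  simp only [deriv_const_add', ← hF b right_mem_uIcc, ← hG b right_mem_uIcc,
    intervalIntegral.integral_same, add_zero] at parts
  have hFg : ∫ x in a..b, F x * g x =
      ∫ x in a..b, (F a + ∫ r in a..x, f r) * deriv (fun x => ∫ r in a..x, g r) x := by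
    refine intervalIntegral.integral_congr_ae ?_
    filter_upwards [hg.ae_hasDerivAt_integral] with x hx hxab
    have hx' := uIoc_subset_uIcc hxab
    rw [(hx hx' a left_mem_uIcc).deriv, hF x hx']
  have hfG : ∫ x in a..b, f x * G x =
      ∫ x in a..b, deriv (fun x => ∫ r in a..x, f r) x * (G a + ∫ r in a..x, g r) := by
    refine intervalIntegral.integral_congr_ae ?_
    filter_upwards [hf.ae_hasDerivAt_integral] with x hx hxab
    have hx' := uIoc_subset_uIcc hxab
    rw [(hx hx' a left_mem_uIcc).deriv, hG x hx']
  rw [hFg, hfG, parts]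

theorem exp_neg_mul_eq_sub_of_integral_eq {G c : ℝ → ℝ} {κ t : ℝ}
    (hG : IntervalIntegrable G volume 0 t) (hc : IntervalIntegrable c volume 0 t)
    (h : ∀ s ∈ uIcc 0 t, G s = G 0 + ∫ r in (0 : ℝ)..s, (κ * G r - c r)) :
    Real.exp (-κ * t) * G t = G 0 - ∫ s in (0 : ℝ)..t, Real.exp (-κ * s) * c s := by
  have hder (s : ℝ) : HasDerivAt (fun s => Real.exp (-κ * s)) (-κ * Real.exp (-κ * s)) s := by
    simpa [mul_comm] using ((hasDerivAt_id s).const_mul (-κ)).exp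
  have hE : Continuous fun s => Real.exp (-κ * s) := by fun_prop
  have hE' : Continuous fun s => -κ * Real.exp (-κ * s) := by fun_prop
  have parts := integral_mul_eq_sub_of_integral_eq (hE'.intervalIntegrable 0 t)
    ((hG.const_mul κ).sub hc)
    (fun s _ => by rw [intervalIntegral.integral_eq_sub_of_hasDerivAt (fun r _ => hder r)
      (hE'.intervalIntegrable 0 s)]; ring) h
  have hcancel : (∫ s in (0 : ℝ)..t, Real.exp (-κ * s) * (κ * G s - c s)) +
      ∫ s in (0 : ℝ)..t, -κ * Real.exp (-κ * s) * G s =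
        -∫ s in (0 : ℝ)..t, Real.exp (-κ * s) * c s := by
    rw [← intervalIntegral.integral_neg, ← intervalIntegral.integral_add
      (((hG.const_mul κ).sub hc).continuousOn_mul hE.continuousOn)
      (hG.continuousOn_mul hE'.continuousOn)]
    congr 1 with s
    ring
  rw [mul_zero, Real.exp_zero, one_mul] at parts
  linarith

theorem eq_exp_mul_of_integral_eq {G : ℝ → ℝ} {κ t : ℝ} (hG : IntervalIntegrable G volume 0 t)
    (h : ∀ s ∈ uIcc 0 t, G s = G 0 + ∫ r in (0 : ℝ)..s, κ * G r) :
    G t = G 0 * Real.exp (κ * t) := by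
  have key := exp_neg_mul_eq_sub_of_integral_eq (c := 0) (κ := κ) hG intervalIntegrable_const
    (by simpa using h)
  have hcancel : Real.exp (-κ * t) * Real.exp (κ * t) = 1 := by
    rw [← Real.exp_add, neg_mul, neg_add_cancel, Real.exp_zero]
  simp only [Pi.zero_apply, mul_zero, intervalIntegral.integral_zero, sub_zero] at key
  rw [← key, mul_right_comm, hcancel, one_mul]

theorem eq_zero_of_integral_eq_zero {E : Type*} [NormedAddCommGroup E] [NormedSpace ℝ E]
    [CompleteSpace E] {f : ℝ → E} (hf : ContinuousOn f (Ici 0))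
    (h : ∀ t, 0 ≤ t → ∫ s in (0 : ℝ)..t, f s = 0) {t : ℝ} (ht : 0 ≤ t) : f t = 0 := by
  have hext : Continuous fun s => f (max s 0) :=
    hf.comp_continuous (by fun_prop) fun s => le_max_right s 0
  have hext_int (r : ℝ) (hr : 0 ≤ r) : ∫ s in (0 : ℝ)..r, f (max s 0) = 0 := by
    rw [← h r hr]
    refine intervalIntegral.integral_congr fun s hs => ?_
    rw [uIcc_of_le hr] at hs
    simp only [max_eq_left hs.1]
  have hderiv : HasDerivWithinAt (fun r => ∫ s in (0 : ℝ)..r, f (max s 0)) (f (max t 0))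
      (Ici t) t := (hext.integral_hasStrictDerivAt 0 t).hasDerivAt.hasDerivWithinAt
  have hzero : HasDerivWithinAt (fun r => ∫ s in (0 : ℝ)..r, f (max s 0)) 0 (Ici t) t :=
    (hasDerivWithinAt_const t (Ici t) (0 : E)).congr (fun r hr => hext_int r (ht.trans hr))
      (hext_int t ht)
  simpa only [max_eq_left ht] using (uniqueDiffOn_Ici t t self_mem_Ici).eq_deriv _ hderiv hzero

theorem eq_zero_of_abs_le_integral {f : ℝ → ℝ} {K : ℝ} (hf : Continuous f)
    (h : ∀ t, 0 ≤ t → |f t| ≤ K * ∫ s in (0 : ℝ)..t, |f s|) {t : ℝ} (ht : 0 ≤ t) : f t = 0 := by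
  have hderiv (s : ℝ) : HasDerivAt (fun t => ∫ s in (0 : ℝ)..t, |f s|) |f s| s :=
    (hf.abs.integral_hasStrictDerivAt 0 s).hasDerivAt
  have hzero : ∫ s in (0 : ℝ)..t, |f s| = 0 :=
    eq_zero_of_abs_deriv_le_mul_abs_self_of_eq_zero_right (K := K) (a := 0) (b := t)
      (fun s _ => (hderiv s).continuousAt.continuousWithinAt)
      (fun s _ => (hderiv s).hasDerivWithinAt) intervalIntegral.integral_same
      (fun s hs => by
        rw [Real.norm_eq_abs, abs_abs, Real.norm_eq_abs,
          abs_of_nonneg (intervalIntegral.integral_nonneg hs.1 fun _ _ => abs_nonneg _)]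
        exact h s hs.1) t ⟨ht, le_rfl⟩
  exact abs_nonpos_iff.1 (by simpa [hzero] using h t ht)

theorem forall_pos_of_forall_nonneg_before {f : ℝ → ℝ} (hf : ContinuousOn f (Ici 0))
    (h : ∀ t, 0 ≤ t → (∀ s ∈ Ico 0 t, 0 ≤ f s) → 0 < f t) {t : ℝ} (ht : 0 ≤ t) : 0 < f t := by
  by_contra hneg
  set S : Set ℝ := Ici 0 ∩ f ⁻¹' Iic 0
  have hSc : IsClosed S := hf.preimage_isClosed_of_isClosed isClosed_Ici isClosed_Iic
  have hSb : BddBelow S := ⟨0, fun s hs => hs.1⟩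
  have hfirst : sInf S ∈ S := hSc.csInf_mem ⟨t, ht, not_lt.1 hneg⟩ hSb
  refine (h (sInf S) hfirst.1 fun s hs => ?_).not_ge hfirst.2
  by_contra hs'
  exact (csInf_le hSb ⟨hs.1, (not_le.1 hs').le⟩).not_gt hs.2

theorem integrableOn_Ioi_and_integral_le_of_bounded {f : ℝ → ℝ} {M : ℝ}
    (hf0 : ∀ t, 0 ≤ t → 0 ≤ f t) (hfi : ∀ t, 0 ≤ t → IntervalIntegrable f volume 0 t)
    (hM : ∀ t, 0 ≤ t → ∫ s in (0 : ℝ)..t, f s ≤ M) :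
    IntegrableOn f (Ioi 0) ∧ ∫ t in Ioi (0 : ℝ), f t ≤ M := by
  have hnorm {t : ℝ} (ht : 0 ≤ t) : ∫ s in (0 : ℝ)..t, ‖f s‖ = ∫ s in (0 : ℝ)..t, f s := by
    refine intervalIntegral.integral_congr fun s hs => ?_
    rw [uIcc_of_le ht] at hs
    exact abs_of_nonneg (hf0 s hs.1)
  have hint : IntegrableOn f (Ioi 0) := by
    refine integrableOn_Ioi_of_intervalIntegral_norm_bounded (b := id) (l := atTop)
      M 0 (fun t => ?_) tendsto_id ?_
    · rcases le_total 0 t with ht | ht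
      · exact (hfi t ht).1
      · simp only [id, Ioc_eq_empty_of_le ht, integrableOn_empty]
    · filter_upwards [eventually_ge_atTop 0] with t ht
      exact (hnorm ht).le.trans (hM t ht)
  refine ⟨hint, le_of_tendsto (intervalIntegral_tendsto_integral_Ioi 0 hint tendsto_id) ?_⟩
  filter_upwards [eventually_ge_atTop 0] with t ht
  exact hM t ht

end IntegralEquations

section FixedPoint

/-- The operator `F` on paths conjugated with the weight `exp (l t)`, and frozen before time `0`.
A causal operator that is Lipschitz for the running integral becomes a contraction of the bounded
continuous functions when `l` is large (Bielecki's weighted norm). -/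
noncomputable def bielecki (l : ℝ) (F : (ℝ → ℝ) → ℝ → ℝ) (j : ℝ → ℝ) (t : ℝ) : ℝ :=
  Real.exp (-(l * max t 0)) * F (fun s => Real.exp (l * s) * j s) (max t 0)

theorem integral_exp_mul_le {l : ℝ} (hl : 0 < l) (t : ℝ) :
    ∫ s in (0 : ℝ)..t, Real.exp (l * s) ≤ Real.exp (l * t) / l := by
  rw [intervalIntegral.integral_comp_mul_left _ hl.ne', integral_exp, mul_zero, Real.exp_zero,
    smul_eq_mul, ← div_eq_inv_mul]
  gcongr
  linarith

variable {F : (ℝ → ℝ) → ℝ → ℝ} {K l M : ℝ}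

theorem exp_neg_max_mul_exp (l t : ℝ) :
    Real.exp (-(l * max t 0)) * Real.exp (l * max t 0) = 1 := by
  rw [← Real.exp_add, neg_add_cancel, Real.exp_zero]

theorem abs_bielecki_sub_le (hK : 0 ≤ K) (hl : 0 < l)
    (hF : ∀ i j : ℝ → ℝ, Continuous i → Continuous j → ∀ t, 0 ≤ t →
      |F i t - F j t| ≤ K * ∫ s in (0 : ℝ)..t, |i s - j s|)
    {i j : ℝ → ℝ} (hi : Continuous i) (hj : Continuous j) {C : ℝ} (hC : ∀ s, |i s - j s| ≤ C)
    (t : ℝ) : |bielecki l F i t - bielecki l F j t| ≤ K / l * C := by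
  set τ := max t 0
  have hτ : 0 ≤ τ := le_max_right t 0
  have hC0 : 0 ≤ C := (abs_nonneg _).trans (hC 0)
  have hint : ∫ s in (0 : ℝ)..τ, |Real.exp (l * s) * i s - Real.exp (l * s) * j s| ≤
      Real.exp (l * τ) / l * C := by
    calc ∫ s in (0 : ℝ)..τ, |Real.exp (l * s) * i s - Real.exp (l * s) * j s|
        ≤ ∫ s in (0 : ℝ)..τ, Real.exp (l * s) * C := by
          refine intervalIntegral.integral_mono_on hτ
            (Continuous.intervalIntegrable (by fun_prop) _ _)
            (Continuous.intervalIntegrable (by fun_prop) _ _) fun s _ => ?_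
          rw [← mul_sub, abs_mul, abs_of_pos (Real.exp_pos _)]
          gcongr
          exact hC s
      _ ≤ Real.exp (l * τ) / l * C := by
          rw [intervalIntegral.integral_mul_const]
          gcongr
          exact integral_exp_mul_le hl τ
  calc |bielecki l F i t - bielecki l F j t|
      = Real.exp (-(l * τ)) * |F (fun s => Real.exp (l * s) * i s) τ -
          F (fun s => Real.exp (l * s) * j s) τ| := by
        rw [bielecki, bielecki, ← mul_sub, abs_mul, abs_of_pos (Real.exp_pos _)]
    _ ≤ Real.exp (-(l * τ)) * (K * (Real.exp (l * τ) / l * C)) := by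
        gcongr
        exact (hF _ _ (by fun_prop) (by fun_prop) τ hτ).trans (by gcongr)
    _ = Real.exp (-(l * τ)) * Real.exp (l * τ) * (K / l * C) := by ring
    _ = K / l * C := by rw [exp_neg_max_mul_exp, one_mul]

theorem abs_bielecki_zero_le (hF0 : ∀ t, 0 ≤ t → |F 0 t| ≤ M * Real.exp (l * t)) (t : ℝ) :
    |bielecki l F 0 t| ≤ M := by
  have hzero : (fun s => Real.exp (l * s) * (0 : ℝ → ℝ) s) = 0 := by
    ext s
    exact mul_zero _
  calc |bielecki l F 0 t| = Real.exp (-(l * max t 0)) * |F 0 (max t 0)| := by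
        rw [bielecki, hzero, abs_mul, abs_of_pos (Real.exp_pos _)]
    _ ≤ Real.exp (-(l * max t 0)) * (M * Real.exp (l * max t 0)) := by
        gcongr
        exact hF0 _ (le_max_right t 0)
    _ = M := by rw [mul_left_comm, exp_neg_max_mul_exp, mul_one]

theorem continuous_bielecki (hFc : ∀ i : ℝ → ℝ, Continuous i → ContinuousOn (F i) (Ici 0))
    {j : ℝ → ℝ} (hj : Continuous j) : Continuous (bielecki l F j) :=
  Continuous.mul (by fun_prop) ((hFc _ (by fun_prop)).comp_continuous (by fun_prop)
    fun t => le_max_right t 0)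

theorem exists_continuous_eq_of_abs_sub_le_integral (hK : 0 ≤ K) (hKl : K < l)
    (hFc : ∀ i : ℝ → ℝ, Continuous i → ContinuousOn (F i) (Ici 0))
    (hF : ∀ i j : ℝ → ℝ, Continuous i → Continuous j → ∀ t, 0 ≤ t →
      |F i t - F j t| ≤ K * ∫ s in (0 : ℝ)..t, |i s - j s|)
    (hF0 : ∀ t, 0 ≤ t → |F 0 t| ≤ M * Real.exp (l * t)) :
    ∃ i : ℝ → ℝ, Continuous i ∧ ∀ t, 0 ≤ t → i t = F i t := by
  have hl : 0 < l := hK.trans_lt hKl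
  have hbound (j : ℝ →ᵇ ℝ) (t : ℝ) : ‖bielecki l F j t‖ ≤ K / l * ‖j‖ + M := by
    have hdiff := abs_bielecki_sub_le hK hl hF j.continuous continuous_zero
      (fun s => by simpa using j.norm_coe_le_norm s) t
    have hzero := abs_bielecki_zero_le hF0 t
    have htri := abs_sub_abs_le_abs_sub (bielecki l F j t) (bielecki l F 0 t)
    rw [Real.norm_eq_abs]
    linarith
  let Φ : (ℝ →ᵇ ℝ) → (ℝ →ᵇ ℝ) := fun j =>
    BoundedContinuousFunction.ofNormedAddCommGroup _ (continuous_bielecki hFc j.continuous) _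
      (hbound j)
  have hΦ : ContractingWith (Real.toNNReal (K / l)) Φ := by
    refine ⟨by simpa using (div_lt_one hl).2 hKl, LipschitzWith.of_dist_le_mul fun i j => ?_⟩
    rw [Real.coe_toNNReal _ (by positivity)]
    refine (BoundedContinuousFunction.dist_le (by positivity)).2 fun t => ?_
    exact abs_bielecki_sub_le hK hl hF i.continuous j.continuous
      (fun s => (Real.dist_eq _ _).symm.trans_le (BoundedContinuousFunction.dist_coe_le_dist s)) t
  obtain ⟨j, hj⟩ : ∃ j : ℝ →ᵇ ℝ, Φ j = j := ⟨_, hΦ.fixedPoint_isFixedPt⟩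
  refine ⟨fun t => Real.exp (l * t) * j t, by fun_prop, fun t ht => ?_⟩
  have hjt : j t = bielecki l F j t := (DFunLike.congr_fun hj t).symm
  have hcancel := exp_neg_max_mul_exp l t
  rw [bielecki] at hjt
  rw [max_eq_left ht] at hjt hcancel
  simp only
  nth_rewrite 1 [hjt]
  rw [← mul_assoc, mul_comm (Real.exp (l * t)), hcancel, one_mul]

end FixedPoint

section PowerUtility

theorem rpow_one_sub_eq_mul {c σ : ℝ} (hc : 0 < c) : c ^ (1 - σ) = c ^ (-σ) * c := by
  rw [← Real.rpow_add_one hc.ne', neg_add_eq_sub]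

theorem rpow_mul_tangent_eq {c c₀ σ : ℝ} (hc₀ : 0 < c₀) :
    c₀ ^ (1 - σ) * (1 + (1 - σ) * (c / c₀ - 1)) =
      c₀ ^ (1 - σ) + (1 - σ) * (c₀ ^ (-σ) * (c - c₀)) := by
  rw [rpow_one_sub_eq_mul hc₀]
  field_simp

theorem rpow_one_sub_le_tangent {c c₀ σ : ℝ} (hσ0 : 0 ≤ σ) (hσ1 : σ ≤ 1) (hc : 0 ≤ c)
    (hc₀ : 0 < c₀) :
    c ^ (1 - σ) ≤ c₀ ^ (1 - σ) + (1 - σ) * (c₀ ^ (-σ) * (c - c₀)) := by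
  have hratio : (c / c₀) ^ (1 - σ) ≤ 1 + (1 - σ) * (c / c₀ - 1) := by
    simpa using rpow_one_add_le_one_add_mul_self (s := c / c₀ - 1)
      (by linarith [div_nonneg hc hc₀.le]) (p := 1 - σ) (by linarith) (by linarith)
  rw [← rpow_mul_tangent_eq hc₀]
  rwa [Real.div_rpow hc hc₀.le, div_le_iff₀' (Real.rpow_pos_of_pos hc₀ _)] at hratio

theorem tangent_le_rpow_one_sub {c c₀ σ : ℝ} (hσ : 1 ≤ σ) (hc : 0 < c) (hc₀ : 0 < c₀) :
    c₀ ^ (1 - σ) + (1 - σ) * (c₀ ^ (-σ) * (c - c₀)) ≤ c ^ (1 - σ) := by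
  have hq : 0 < c / c₀ := div_pos hc hc₀
  have hratio : 1 + (1 - σ) * (c / c₀ - 1) ≤ (c / c₀) ^ (1 - σ) := by
    calc 1 + (1 - σ) * (c / c₀ - 1) ≤ 1 + (1 - σ) * Real.log (c / c₀) := by
          linarith [mul_le_mul_of_nonpos_left (Real.log_le_sub_one_of_pos hq)
            (by linarith : 1 - σ ≤ 0)]
      _ ≤ Real.exp (Real.log (c / c₀) * (1 - σ)) := by
          linarith [Real.add_one_le_exp (Real.log (c / c₀) * (1 - σ))]
      _ = (c / c₀) ^ (1 - σ) := (Real.rpow_def_of_pos hq _).symm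
  rw [← rpow_mul_tangent_eq hc₀]
  rwa [Real.div_rpow hc.le hc₀.le, le_div_iff₀' (Real.rpow_pos_of_pos hc₀ _)] at hratio

theorem ofReal_mul_rpow_ofReal {p c : ℝ} (hp : 0 ≤ p) (hc : 0 < c) (r : ℝ) :
    ENNReal.ofReal p * ENNReal.ofReal c ^ r = ENNReal.ofReal (p * c ^ r) := by
  rw [ENNReal.ofReal_rpow_of_pos hc, ENNReal.ofReal_mul hp]

theorem ofReal_rpow_add_le_of_lt_one {p c c₀ σ : ℝ} (hσ0 : 0 ≤ σ) (hσ1 : σ < 1) (hp : 0 ≤ p)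
    (hc : 0 ≤ c) (hc₀ : 0 < c₀) :
    ENNReal.ofReal p * ENNReal.ofReal c ^ (1 - σ) +
        ENNReal.ofReal ((1 - σ) * (p * c₀ ^ (-σ) * c₀)) ≤
      ENNReal.ofReal p * ENNReal.ofReal c₀ ^ (1 - σ) +
        ENNReal.ofReal ((1 - σ) * (p * c₀ ^ (-σ) * c)) := by
  have hσ' : 0 < 1 - σ := sub_pos.2 hσ1
  have htangent := mul_le_mul_of_nonneg_left
    (rpow_one_sub_le_tangent hσ0 hσ1.le hc hc₀) hp
  rw [ENNReal.ofReal_rpow_of_nonneg hc hσ'.le, ← ENNReal.ofReal_mul hp,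
    ofReal_mul_rpow_ofReal hp hc₀, ← ENNReal.ofReal_add (by positivity) (by positivity),
    ← ENNReal.ofReal_add (by positivity) (by positivity)]
  exact ENNReal.ofReal_le_ofReal (by linear_combination htangent)

theorem ofReal_rpow_add_le_of_one_lt {p c c₀ σ : ℝ} (hσ : 1 < σ) (hp : 0 < p)
    (hc : 0 ≤ c) (hc₀ : 0 < c₀) :
    ENNReal.ofReal p * ENNReal.ofReal c₀ ^ (1 - σ) +
        ENNReal.ofReal ((σ - 1) * (p * c₀ ^ (-σ) * c₀)) ≤
      ENNReal.ofReal p * ENNReal.ofReal c ^ (1 - σ) +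
        ENNReal.ofReal ((σ - 1) * (p * c₀ ^ (-σ) * c)) := by
  have : 0 < σ - 1 := sub_pos.2 hσ
  rcases hc.eq_or_lt with rfl | hc
  · rw [ENNReal.ofReal_zero, ENNReal.zero_rpow_of_neg (sub_neg.2 hσ),
      ENNReal.mul_top (ENNReal.ofReal_pos.2 hp).ne', top_add]
    exact le_top
  have htangent := mul_le_mul_of_nonneg_left (tangent_le_rpow_one_sub hσ.le hc hc₀) hp.le
  rw [ofReal_mul_rpow_ofReal hp.le hc, ofReal_mul_rpow_ofReal hp.le hc₀,
    ← ENNReal.ofReal_add (by positivity) (by positivity),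
    ← ENNReal.ofReal_add (by positivity) (by positivity)]
  exact ENNReal.ofReal_le_ofReal (by linear_combination htangent)

variable {Ω : Type*} [MeasurableSpace Ω] {μ : Measure Ω}

theorem lintegral_le_of_add_ofReal_le {f g : Ω → ℝ≥0∞} {P Q : Ω → ℝ} (hP : Integrable P μ)
    (hQ : Integrable Q μ) (hP0 : 0 ≤ᵐ[μ] P) (hQ0 : 0 ≤ᵐ[μ] Q) (hQP : ∫ t, Q t ∂μ ≤ ∫ t, P t ∂μ)
    (h : ∀ᵐ t ∂μ, f t + ENNReal.ofReal (P t) ≤ g t + ENNReal.ofReal (Q t)) :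
    ∫⁻ t, f t ∂μ ≤ ∫⁻ t, g t ∂μ := by
  have hfinite : ∫⁻ t, ENNReal.ofReal (P t) ∂μ ≠ ⊤ := by
    rw [← ofReal_integral_eq_lintegral_ofReal hP hP0]
    exact ENNReal.ofReal_ne_top
  refine (ENNReal.add_le_add_iff_right hfinite).1 ?_
  calc ∫⁻ t, f t ∂μ + ∫⁻ t, ENNReal.ofReal (P t) ∂μ
      ≤ ∫⁻ t, (f t + ENNReal.ofReal (P t)) ∂μ := le_lintegral_add _ _
    _ ≤ ∫⁻ t, (g t + ENNReal.ofReal (Q t)) ∂μ := lintegral_mono_ae h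
    _ = ∫⁻ t, g t ∂μ + ∫⁻ t, ENNReal.ofReal (Q t) ∂μ :=
        lintegral_add_right' _ hQ.aestronglyMeasurable.aemeasurable.ennreal_ofReal
    _ ≤ ∫⁻ t, g t ∂μ + ∫⁻ t, ENNReal.ofReal (P t) ∂μ := by
        rw [← ofReal_integral_eq_lintegral_ofReal hP hP0,
          ← ofReal_integral_eq_lintegral_ofReal hQ hQ0]
        gcongr

/-- Total utility `∫ p c^(1-σ) / (1-σ) dμ` of a consumption plan `c`, with discount weight `p`.
The integral is a lower one and takes values in `[0, ∞]`, so that the plan may vanish when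
`σ > 1`; the sign of `1 - σ` is restored outside it. -/
noncomputable def powerUtility (μ : Measure Ω) (p : Ω → ℝ) (σ : ℝ) (c : Ω → ℝ) : EReal :=
  (((1 - σ)⁻¹ : ℝ) : EReal) *
    ((∫⁻ t, ENNReal.ofReal (p t) * ENNReal.ofReal (c t) ^ (1 - σ) ∂μ : ℝ≥0∞) : EReal)

variable {p c c₀ : Ω → ℝ} {σ : ℝ}

-- `p c₀^(-σ)` is the marginal utility at `c₀`: read as a price, it supports `c₀`.
theorem powerUtility_le_of_integral_mul_le (hσ0 : 0 ≤ σ) (hσ1 : σ ≠ 1)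
    (hp : ∀ᵐ t ∂μ, 0 < p t) (hc : ∀ᵐ t ∂μ, 0 ≤ c t) (hc₀ : ∀ᵐ t ∂μ, 0 < c₀ t)
    (hint : Integrable (fun t => p t * c₀ t ^ (-σ) * c t) μ)
    (hint₀ : Integrable (fun t => p t * c₀ t ^ (-σ) * c₀ t) μ)
    (hle : ∫ t, p t * c₀ t ^ (-σ) * c t ∂μ ≤ ∫ t, p t * c₀ t ^ (-σ) * c₀ t ∂μ) :
    powerUtility μ p σ c ≤ powerUtility μ p σ c₀ := by
  have hnonneg {κ : ℝ} (hκ : 0 ≤ κ) {d : Ω → ℝ} (hd : ∀ᵐ t ∂μ, 0 ≤ d t) :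
      0 ≤ᵐ[μ] fun t => κ * (p t * c₀ t ^ (-σ) * d t) := by
    filter_upwards [hp, hc₀, hd] with t hpt hc₀t hdt
    simp only [Pi.zero_apply]
    positivity
  have hscaled {κ : ℝ} (hκ : 0 ≤ κ) : ∫ t, κ * (p t * c₀ t ^ (-σ) * c t) ∂μ ≤
      ∫ t, κ * (p t * c₀ t ^ (-σ) * c₀ t) ∂μ := by
    rw [integral_const_mul, integral_const_mul]
    gcongr
  have hc₀' : ∀ᵐ t ∂μ, 0 ≤ c₀ t := hc₀.mono fun t ht => ht.le
  rcases lt_or_gt_of_ne hσ1 with hσ | hσ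
  · have hκ : 0 ≤ 1 - σ := by linarith
    refine mul_le_mul_of_nonneg_left (EReal.coe_ennreal_le_coe_ennreal_iff.2 ?_)
      (EReal.coe_nonneg.2 (inv_nonneg.2 hκ))
    refine lintegral_le_of_add_ofReal_le (hint₀.const_mul _) (hint.const_mul _)
      (hnonneg hκ hc₀') (hnonneg hκ hc) (hscaled hκ) ?_
    filter_upwards [hp, hc, hc₀] with t hpt hct hc₀t
    exact ofReal_rpow_add_le_of_lt_one hσ0 hσ hpt.le hct hc₀t
  · have hκ : 0 ≤ σ - 1 := by linarith
    rw [powerUtility, powerUtility, ← neg_sub σ 1, inv_neg, EReal.coe_neg, EReal.neg_mul,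
      EReal.neg_mul, EReal.neg_le_neg_iff, neg_sub]
    refine mul_le_mul_of_nonneg_left (EReal.coe_ennreal_le_coe_ennreal_iff.2 ?_)
      (EReal.coe_nonneg.2 (inv_nonneg.2 hκ))
    refine lintegral_le_of_add_ofReal_le (hint₀.const_mul _) (hint.const_mul _)
      (hnonneg hκ hc₀') (hnonneg hκ hc) (hscaled hκ) ?_
    filter_upwards [hp, hc, hc₀] with t hpt hct hc₀t
    exact ofReal_rpow_add_le_of_one_lt hσ hpt hct hc₀t

end PowerUtility

section ExponentialConsumption

variable {σ ρ ξ θ C : ℝ}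

theorem exp_mul_rpow_exp_neg (hC : 0 ≤ C) (hθ : σ * (ξ - θ) = ξ - ρ) (t : ℝ) :
    Real.exp (-ρ * t) * (C * Real.exp ((ξ - θ) * t)) ^ (-σ) =
      C ^ (-σ) * Real.exp (-ξ * t) := by
  rw [Real.mul_rpow hC (Real.exp_pos _).le, ← Real.exp_mul, mul_left_comm, ← Real.exp_add]
  congr 2
  linear_combination (-t) * hθ

theorem exp_mul_exp_sub (ξ θ t : ℝ) :
    Real.exp (-ξ * t) * Real.exp ((ξ - θ) * t) = Real.exp (-θ * t) := by
  rw [← Real.exp_add]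
  ring_nf

theorem integral_Ioi_exp_neg_mul (hθ : 0 < θ) :
    ∫ t in Ioi (0 : ℝ), Real.exp (-θ * t) = θ⁻¹ := by
  rw [integral_exp_mul_Ioi (neg_lt_zero.2 hθ) 0, mul_zero, Real.exp_zero, neg_div_neg_eq, one_div]

theorem powerUtility_exp (hθ0 : 0 < θ) (hC : 0 < C) (hθ : σ * (ξ - θ) = ξ - ρ) :
    powerUtility (volume.restrict (Ioi 0)) (fun t => Real.exp (-ρ * t)) σ
        (fun t => C * Real.exp ((ξ - θ) * t)) =
      (((1 - σ)⁻¹ * (C ^ (1 - σ) / θ) : ℝ) : EReal) := by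
  have hpoint (t : ℝ) : ENNReal.ofReal (Real.exp (-ρ * t)) *
      ENNReal.ofReal (C * Real.exp ((ξ - θ) * t)) ^ (1 - σ) =
        ENNReal.ofReal (C ^ (1 - σ) * Real.exp (-θ * t)) := by
    have hc : 0 < C * Real.exp ((ξ - θ) * t) := by positivity
    rw [ofReal_mul_rpow_ofReal (Real.exp_pos _).le hc, rpow_one_sub_eq_mul hc, ← mul_assoc,
      exp_mul_rpow_exp_neg hC.le hθ, rpow_one_sub_eq_mul hC, ← exp_mul_exp_sub ξ θ]
    congr 1
    ring
  have hint : IntegrableOn (fun t => C ^ (1 - σ) * Real.exp (-θ * t)) (Ioi 0) :=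
    (exp_neg_integrableOn_Ioi 0 hθ0).const_mul _
  have hpos : 0 ≤ C ^ (1 - σ) / θ := by positivity
  simp only [powerUtility, hpoint]
  rw [← ofReal_integral_eq_lintegral_ofReal hint (Eventually.of_forall fun t => by positivity),
    integral_const_mul, integral_Ioi_exp_neg_mul hθ0, ← div_eq_mul_inv,
    EReal.coe_ennreal_ofReal, max_eq_left hpos, ← EReal.coe_mul]

theorem powerUtility_le_exp_of_budget (hσ0 : 0 ≤ σ) (hσ1 : σ ≠ 1) (hθ0 : 0 < θ) (hC : 0 < C)
    (hθ : σ * (ξ - θ) = ξ - ρ) {c : ℝ → ℝ} (hc : ∀ t, 0 ≤ t → 0 ≤ c t)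
    (hint : IntegrableOn (fun t => Real.exp (-ξ * t) * c t) (Ioi 0))
    (hbudget : ∫ t in Ioi (0 : ℝ), Real.exp (-ξ * t) * c t ≤ C / θ) :
    powerUtility (volume.restrict (Ioi 0)) (fun t => Real.exp (-ρ * t)) σ c ≤
      powerUtility (volume.restrict (Ioi 0)) (fun t => Real.exp (-ρ * t)) σ
        (fun t => C * Real.exp ((ξ - θ) * t)) := by
  have hprice₀ (t : ℝ) : C ^ (-σ) * Real.exp (-ξ * t) * (C * Real.exp ((ξ - θ) * t)) =
      C ^ (-σ) * C * Real.exp (-θ * t) := by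
    rw [← exp_mul_exp_sub ξ θ]
    ring
  refine powerUtility_le_of_integral_mul_le hσ0 hσ1 (Eventually.of_forall fun t => Real.exp_pos _)
    ((ae_restrict_mem measurableSet_Ioi).mono fun t ht => hc t (le_of_lt ht))
    (Eventually.of_forall fun t => by positivity) ?_ ?_ ?_ <;>
    simp only [exp_mul_rpow_exp_neg hC.le hθ, hprice₀]
  · simpa only [mul_assoc] using hint.const_mul (C ^ (-σ))
  · exact (exp_neg_integrableOn_Ioi 0 hθ0).const_mul _
  · simp only [mul_assoc]
    rw [integral_const_mul, integral_const_mul, integral_const_mul, integral_Ioi_exp_neg_mul hθ0,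
      ← div_eq_mul_inv]
    gcongr

end ExponentialConsumption

section InvestmentWindow

variable {T R t : ℝ} {ι : L2Hist T} {i j : ℝ → ℝ}

/-- Membership in `L²_loc([0, ∞))`. -/
def MemL2Loc (j : ℝ → ℝ) : Prop := ∀ R : ℝ, MemLp j 2 (volume.restrict (Icc 0 R))

theorem MemL2Loc.of_continuousOn (hj : ContinuousOn j (Ici 0)) : MemL2Loc j := fun R => by
  have hjR : ContinuousOn j (Icc 0 R) := hj.mono Icc_subset_Ici_self
  obtain ⟨M, hM⟩ := isCompact_Icc.exists_bound_of_continuousOn hjR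
  exact MemLp.of_bound (hjR.aestronglyMeasurable measurableSet_Icc) M
    ((ae_restrict_iff' measurableSet_Icc).2 (.of_forall hM))

theorem MemL2Loc.integrableOn (hj : MemL2Loc j) (R : ℝ) : IntegrableOn j (Icc 0 R) :=
  (hj R).integrable one_le_two

theorem MemL2Loc.intervalIntegrable (hj : MemL2Loc j) (ht : 0 ≤ t) :
    IntervalIntegrable j volume 0 t :=
  (intervalIntegrable_iff_integrableOn_Icc_of_le ht).2 (hj.integrableOn t)

theorem L2Hist.integrableOn (z : L2Hist T) : IntegrableOn z (Ioo (-T) 0) :=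
  (Lp.memLp z).integrable one_le_two

theorem L2Hist.intervalIntegrable (hT : 0 ≤ T) (z : L2Hist T) :
    IntervalIntegrable z volume (-T) 0 :=
  (intervalIntegrable_iff_integrableOn_Ioo_of_le (neg_nonpos.2 hT)).2 z.integrableOn

theorem setIntegral_hist_eq (hT : 0 ≤ T) (f : ℝ → ℝ) :
    ∫ s in Ioo (-T) 0, f s = ∫ s in (-T)..0, f s := by
  rw [intervalIntegral.integral_of_le (neg_nonpos.2 hT), integral_Ioc_eq_integral_Ioo]

/-- The investment path on `(-T, R]`, extended by zero to a square integrable function on `ℝ`. -/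
noncomputable def truncatedInvestment (ι : L2Hist T) (j : ℝ → ℝ) (R : ℝ) : ℝ → ℝ :=
  (Ioo (-T) 0).indicator ι + (Icc 0 R).indicator j

theorem truncatedInvestment_eq_investment {s : ℝ} (hs : s ∈ Ioc (-T) R) :
    truncatedInvestment ι j R s = investment ι j s := by
  rcases lt_or_ge s 0 with h | h
  · simp [truncatedInvestment, investment, hs.1, h, not_le.2 h]
  · simp [truncatedInvestment, investment, hs.2, h, not_lt.2 h]

theorem memLp_truncatedInvestment (hj : MemL2Loc j) :
    MemLp (truncatedInvestment ι j R) 2 volume :=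
  ((memLp_indicator_iff_restrict measurableSet_Ioo).2 (Lp.memLp ι)).add
    ((memLp_indicator_iff_restrict measurableSet_Icc).2 (hj R))

theorem integrable_truncatedInvestment (hj : MemL2Loc j) :
    Integrable (truncatedInvestment ι j R) volume :=
  ((integrable_indicator_iff measurableSet_Ioo).2 ι.integrableOn).add
    ((integrable_indicator_iff measurableSet_Icc).2 (hj.integrableOn R))

theorem capital_eq_integral_window (hT : 0 ≤ T) (hj : MemL2Loc j) (ht : t ∈ Icc 0 R) :
    capital ι j t = ∫ s in (t - T)..t, truncatedInvestment ι j R s := by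
  have hE : Integrable (truncatedInvestment ι j R) volume := integrable_truncatedInvestment hj
  have hI (a b : ℝ) : IntervalIntegrable (truncatedInvestment ι j R) volume a b :=
    hE.intervalIntegrable
  have h_hist : ∫ s in Ioo (-T) 0, ι s = ∫ s in (-T)..0, truncatedInvestment ι j R s := by
    rw [← setIntegral_hist_eq hT]
    refine setIntegral_congr_fun measurableSet_Ioo fun s hs => ?_
    simp [truncatedInvestment, hs.1, hs.2]
  have h_flow : ∫ s in (0 : ℝ)..t, (investment ι j s - investment ι j (s - T)) =
      ∫ s in (0 : ℝ)..t, (truncatedInvestment ι j R s - truncatedInvestment ι j R (s - T)) := by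
    rw [intervalIntegral.integral_of_le ht.1, intervalIntegral.integral_of_le ht.1]
    refine setIntegral_congr_fun measurableSet_Ioc fun s hs => ?_
    rw [truncatedInvestment_eq_investment ⟨by linarith [hs.1], hs.2.trans ht.2⟩,
      truncatedInvestment_eq_investment ⟨by linarith [hs.1], by linarith [hs.2, ht.2]⟩]
  rw [capital, h_hist, h_flow, intervalIntegral.integral_sub (hI _ _)
    (hE.comp_sub_right T).intervalIntegrable, intervalIntegral.integral_comp_sub_right, zero_sub]
  have h_left := intervalIntegral.integral_add_adjacent_intervals (hI (-T) 0) (hI 0 t)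
  have h_right := intervalIntegral.integral_add_adjacent_intervals (hI (-T) (t - T)) (hI (t - T) t)
  linarith

theorem continuous_integral_window {f : ℝ → ℝ} (hf : Integrable f) (T : ℝ) :
    Continuous fun t => ∫ s in (t - T)..t, f s := by
  have hI (a b : ℝ) : IntervalIntegrable f volume a b := hf.intervalIntegrable
  have hP := intervalIntegral.continuous_primitive hI 0
  have h_sub (t : ℝ) : ∫ s in (t - T)..t, f s =
      (∫ s in (0 : ℝ)..t, f s) - ∫ s in (0 : ℝ)..(t - T), f s :=
    (intervalIntegral.integral_interval_sub_left (hI _ _) (hI _ _)).symm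
  simp only [h_sub]
  exact hP.sub (hP.comp (continuous_sub_right T))

theorem continuousOn_capital (hT : 0 ≤ T) (hj : MemL2Loc j) :
    ContinuousOn (capital ι j) (Ici 0) := fun t ht => by
  have h_window := (continuous_integral_window
    (integrable_truncatedInvestment (ι := ι) (R := t + 1) hj) T).continuousWithinAt
      (s := Ici 0) (x := t)
  refine h_window.congr_of_eventuallyEq ?_
    (capital_eq_integral_window hT hj ⟨ht, (lt_add_one t).le⟩)
  filter_upwards [self_mem_nhdsWithin, mem_nhdsWithin_of_mem_nhds (Iio_mem_nhds (lt_add_one t))]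
    with s hs hst
  exact capital_eq_integral_window hT hj ⟨hs, hst.le⟩

theorem abs_integral_window_le {f : ℝ → ℝ} {s : Set ℝ} (hT : 0 ≤ T) (hs : MeasurableSet s)
    (hf : IntegrableOn f s) : |∫ r in (t - T)..t, s.indicator f r| ≤ ∫ r in s, |f r| := by
  have hfs : Integrable (fun r => |s.indicator f r|) := ((integrable_indicator_iff hs).2 hf).abs
  calc |∫ r in (t - T)..t, s.indicator f r|
      ≤ ∫ r in (t - T)..t, |s.indicator f r| :=
        intervalIntegral.abs_integral_le_integral_abs (sub_le_self t hT)
    _ ≤ ∫ r, |s.indicator f r| := by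
        rw [intervalIntegral.integral_of_le (sub_le_self t hT)]
        exact setIntegral_le_integral hfs (.of_forall fun _ => abs_nonneg _)
    _ = ∫ r in s, |f r| := by
        rw [← integral_indicator hs]
        exact integral_congr_ae (.of_forall fun r => (congrFun (indicator_comp_of_zero
          (g := fun x : ℝ => |x|) abs_zero) r).symm)

theorem abs_capital_sub_le (hT : 0 ≤ T) (hi : MemL2Loc i) (hj : MemL2Loc j) (ht : 0 ≤ t) :
    |capital ι i t - capital ι j t| ≤ ∫ s in (0 : ℝ)..t, |i s - j s| := by
  have h_diff : capital ι i t - capital ι j t =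
      ∫ s in (t - T)..t, (Icc 0 t).indicator (fun r => i r - j r) s := by
    rw [capital_eq_integral_window hT hi ⟨ht, le_rfl⟩,
      capital_eq_integral_window hT hj ⟨ht, le_rfl⟩,
      ← intervalIntegral.integral_sub (integrable_truncatedInvestment hi).intervalIntegrable
        (integrable_truncatedInvestment hj).intervalIntegrable]
    refine intervalIntegral.integral_congr fun s _ => ?_
    by_cases hs : s ∈ Icc 0 t <;> simp [truncatedInvestment, hs]
  rw [h_diff, intervalIntegral.integral_of_le ht, ← integral_Icc_eq_integral_Ioc]
  exact abs_integral_window_le hT measurableSet_Icc ((hi.integrableOn t).sub (hj.integrableOn t))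

theorem abs_capital_zero_le (hT : 0 ≤ T) (ht : 0 ≤ t) :
    |capital ι 0 t| ≤ ∫ s in Ioo (-T) 0, |ι s| := by
  have h_zero : MemL2Loc 0 := fun R => .zero
  have h_capital : capital ι 0 t = ∫ s in (t - T)..t, (Ioo (-T) 0).indicator ι s := by
    rw [capital_eq_integral_window hT h_zero ⟨ht, le_rfl⟩]
    simp [truncatedInvestment]
  rw [h_capital]
  exact abs_integral_window_le hT measurableSet_Ioo ι.integrableOn

theorem investment_congr (hij : EqOn i j (Ici 0)) : investment ι i = investment ι j := by
  ext s
  unfold investment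
  split_ifs with hs
  · rfl
  · exact hij (not_lt.1 hs)

end InvestmentWindow

section StatePath

variable {T : ℝ} {ι : L2Hist T} {j : ℝ → ℝ}

/-- The state `(∫ ι, F(ι))` of the delay system at time `0`. -/
noncomputable def initialState (ι : L2Hist T) : StateSpace T :=
  WithLp.toLp 2 (∫ s in Ioo (-T) 0, ι s, histF T ι)

/-- `y` is the path of the states `(k(t), F(i_t))` generated by the control `j` from the datum `ι`,
where `i_t(s) = i(t + s)` is the investment history at time `t`. -/
def IsStatePath (ι : L2Hist T) (j : ℝ → ℝ) (y : ℝ → StateSpace T) : Prop :=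
  ∀ t, 0 ≤ t → (y t).fst = capital ι j t ∧
    (y t).snd =ᵐ[histMeasure T] fun s => -investment ι j (t - T - s)

theorem IsStatePath.eqOn {y z : ℝ → StateSpace T} (hy : IsStatePath ι j y)
    (hz : IsStatePath ι j z) : EqOn y z (Ici 0) := fun t ht =>
  WithLp.ofLp_injective 2 <| Prod.ext ((hy t ht).1.trans (hz t ht).1.symm)
    (Lp.ext ((hy t ht).2.trans (hz t ht).2.symm))

theorem IsStatePath.congr {i : ℝ → ℝ} {y : ℝ → StateSpace T} (hy : IsStatePath ι i y)
    (hij : EqOn i j (Ici 0)) : IsStatePath ι j y := by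
  simpa only [IsStatePath, capital, investment_congr hij] using hy

theorem IsStatePath.apply_zero {y : ℝ → StateSpace T} (hy : IsStatePath ι j y) :
    y 0 = initialState ι := by
  refine WithLp.ofLp_injective 2 (Prod.ext ?_ (Lp.ext ?_))
  · simp [(hy 0 le_rfl).1, capital, initialState]
  · have h_reflect := (Lp.coeFn_neg _).trans
      (Lp.coeFn_compMeasurePreserving ι (measurePreserving_reflect T)).neg
    refine (hy 0 le_rfl).2.trans (EventuallyEq.trans ?_ h_reflect.symm)
    filter_upwards [ae_restrict_mem measurableSet_Ioo] with s hs
    simp [investment, show -T - s < 0 by linarith [hs.1]]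

theorem exists_continuous_translate {f : ℝ → ℝ} (hf : MemLp f 2 volume) (T : ℝ) :
    ∃ z : ℝ → L2Hist T, Continuous z ∧ ∀ t, z t =ᵐ[histMeasure T] fun s => f (s - t) := by
  have : Fact ((2 : ℝ≥0∞) ≠ ⊤) := ⟨by norm_num⟩
  let translate (t : ℝ) : Lp ℝ 2 (volume : Measure ℝ) := DomAddAct.mk (-t) +ᵥ hf.toLp f
  have h_cont : Continuous translate :=
    (DomAddAct.continuous_mk.comp continuous_neg).vadd continuous_const
  refine ⟨fun t => LpToLpRestrictCLM ℝ ℝ ℝ volume 2 (Ioo (-T) 0) (translate t),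
    (LpToLpRestrictCLM ℝ ℝ ℝ volume 2 (Ioo (-T) 0)).continuous.comp h_cont, fun t => ?_⟩
  have h_translate : translate t =ᵐ[volume] fun s => f (s - t) := by
    simp only [translate, DomAddAct.mk_vadd_toLp]
    refine (MemLp.coeFn_toLp _).trans (.of_forall fun s => ?_)
    simp only [vadd_eq_add, neg_add_eq_sub]
  exact (LpToLpRestrictCLM_coeFn ℝ (Ioo (-T) 0) (translate t)).trans
    (ae_restrict_of_ae h_translate)

theorem exists_continuous_eq_state_of_le (hT : 0 ≤ T) (hj : MemL2Loc j) (R : ℝ) :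
    ∃ y : ℝ → StateSpace T, Continuous y ∧ ∀ t ∈ Icc 0 R, (y t).fst = capital ι j t ∧
      (y t).snd =ᵐ[histMeasure T] fun s => -investment ι j (t - T - s) := by
  obtain ⟨z, hz, hz_eq⟩ := exists_continuous_translate
    ((memLp_truncatedInvestment (ι := ι) (R := R) hj).neg.comp_measurePreserving
      (Measure.measurePreserving_sub_left volume (-T))) T
  refine ⟨fun t => WithLp.toLp 2 (∫ s in (t - T)..t, truncatedInvestment ι j R s, z t),
    (WithLp.prod_continuous_toLp 2 _ _).comp
      ((continuous_integral_window (integrable_truncatedInvestment hj) T).prodMk hz),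
    fun t ht => ⟨(capital_eq_integral_window hT hj ht).symm, (hz_eq t).trans ?_⟩⟩
  filter_upwards [ae_restrict_mem measurableSet_Ioo] with s hs
  have h_arg : -T - (s - t) = t - T - s := by ring
  simp only [Function.comp_apply, Pi.neg_apply, h_arg]
  rw [truncatedInvestment_eq_investment ⟨by linarith [hs.2, ht.1], by linarith [hs.1, ht.2]⟩]

theorem exists_isStatePath (hT : 0 ≤ T) (hj : MemL2Loc j) :
    ∃ y : ℝ → StateSpace T, ContinuousOn y (Ici 0) ∧ IsStatePath ι j y := by
  choose Y hYc hY using exists_continuous_eq_state_of_le (ι := ι) hT hj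
  have h_path : IsStatePath ι j fun t => Y t t := fun t ht => hY t t ⟨ht, le_rfl⟩
  have h_glue (R t : ℝ) (ht : t ∈ Icc 0 R) : Y t t = Y R t :=
    WithLp.ofLp_injective 2 <| Prod.ext ((h_path t ht.1).1.trans (hY R t ht).1.symm)
      (Lp.ext ((h_path t ht.1).2.trans (hY R t ht).2.symm))
  refine ⟨fun t => Y t t, fun t ht => ?_, h_path⟩
  refine (hYc (t + 1)).continuousWithinAt.congr_of_eventuallyEq ?_
    (h_glue _ _ ⟨ht, (lt_add_one t).le⟩)
  filter_upwards [self_mem_nhdsWithin, mem_nhdsWithin_of_mem_nhds (Iio_mem_nhds (lt_add_one t))]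
    with s hs hst
  exact h_glue _ _ ⟨hs, hst.le⟩

end StatePath

section ControlledEquation

variable {T t : ℝ} {ι : L2Hist T} {j : ℝ → ℝ}

/-- `y ∈ C([0,∞); X)` solves `y' = 𝒜^* y + B^* u`, `y(0) = x`, in `D(𝒜)'`; the closed-loop equation
is the case `u = φ ∘ y`. -/
def IsControlledSolution (x : StateSpace T) (u : ℝ → ℝ) (y : ℝ → StateSpace T) : Prop :=
  ContinuousOn y (Ici 0) ∧ y 0 = x ∧
    ∀ ψ : DomA T, ∀ t : ℝ, 0 ≤ t →
      inner ℝ (y t) ψ.val = inner ℝ x ψ.val + ∫ s in (0 : ℝ)..t, (adjA (y s) ψ + adjB (u s) ψ)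

theorem inner_state_eq (x y : StateSpace T) :
    inner ℝ x y = x.fst * y.fst + ∫ s in Ioo (-T) 0, x.snd s * y.snd s := by
  rw [WithLp.prod_inner_apply, L2.inner_def]
  simp only [RCLike.inner_apply, conj_trivial, mul_comm]
  rfl

theorem DomA.inner_val (x : StateSpace T) (ψ : DomA T) :
    inner ℝ x ψ.val = x.fst * ψ.rep 0 + ∫ s in Ioo (-T) 0, x.snd s * ψ.rep s := by
  rw [inner_state_eq, ψ.fst_eq, integral_congr_ae (ψ.snd_ae_eq.mono fun s hs => by rw [hs])]

theorem adjA_eq_integral (x : StateSpace T) (ψ : DomA T) :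
    adjA x ψ = ∫ s in Ioo (-T) 0, x.snd s * ψ.der s := by
  rw [adjA, inner_state_eq]
  simp [DomA.opA]

theorem DomA.rep_eq_add_integral (hT : 0 ≤ T) (ψ : DomA T) {s : ℝ} (hs : s ∈ uIcc (-T) 0) :
    ψ.rep s = ψ.rep (-T) + ∫ r in (-T)..s, ψ.der r := by
  have h0 : -T ≤ 0 := neg_nonpos.2 hT
  have hD := ψ.der.intervalIntegrable hT
  have h_split := intervalIntegral.integral_add_adjacent_intervals
    (hD.mono_set (uIcc_subset_uIcc_left hs)) (hD.mono_set (uIcc_subset_uIcc_right hs))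
  rw [uIcc_of_le h0] at hs
  linarith [ψ.rep_eq s hs, ψ.rep_eq (-T) ⟨le_rfl, h0⟩]

theorem DomA.opB_eq_integral (hT : 0 ≤ T) (ψ : DomA T) : ψ.opB = ∫ r in Ioo (-T) 0, ψ.der r := by
  rw [setIntegral_hist_eq hT, DomA.opB, ψ.rep_eq_add_integral hT right_mem_uIcc,
    add_sub_cancel_left]

theorem integral_window_mul_rep_sub (hT : 0 ≤ T) (ψ : DomA T) {f : ℝ → ℝ} (hf : Integrable f)
    (t : ℝ) :
    (∫ s in (t - T)..t, f s) * ψ.rep 0 - ∫ s in Ioo (-T) 0, f (t - T - s) * ψ.rep s =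
      ∫ r in Ioo (-T) 0, ψ.der r * ∫ s in (t - T - r)..t, f s := by
  have h_prim (x : ℝ) : ∫ r in (-T)..x, f (t - T - r) = ∫ s in (t - T - x)..t, f s := by
    rw [intervalIntegral.integral_comp_sub_left, sub_neg_eq_add, sub_add_cancel]
  have h_parts := integral_mul_eq_sub_of_integral_eq (F := fun x => ∫ s in (t - T - x)..t, f s)
    (hf.comp_sub_left (t - T)).intervalIntegrable (ψ.der.intervalIntegrable hT)
    (fun x _ => by simp [h_prim]) (fun x hx => ψ.rep_eq_add_integral hT hx)
  simp only [sub_zero, sub_neg_eq_add, sub_add_cancel, intervalIntegral.integral_same, zero_mul]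
    at h_parts
  simpa only [setIntegral_hist_eq hT, mul_comm (ψ.der _)] using h_parts.symm

theorem integral_integral_comp_sub_mul {f D : ℝ → ℝ} {μ : Measure ℝ} [SFinite μ] (hf : Integrable f)
    (hD : Integrable D μ) (a b : ℝ) :
    ∫ τ in a..b, ∫ s, f (τ - s) * D s ∂μ = ∫ s, D s * (∫ r in (a - s)..(b - s), f r) ∂μ := by
  have h_int : Integrable (Function.uncurry fun τ s => D s * f (τ - s))
      ((volume.restrict (uIoc a b)).prod μ) :=
    (hD.convolution_integrand (ContinuousLinearMap.mul ℝ ℝ) hf).mono_measure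
      (Measure.prod_mono Measure.restrict_le_self le_rfl)
  simp only [mul_comm (f _)]
  rw [intervalIntegral_integral_swap h_int]
  simp only [intervalIntegral.integral_const_mul, intervalIntegral.integral_comp_sub_right]

theorem intervalIntegrable_adjA {y : ℝ → StateSpace T} (hy : ContinuousOn y (Ici 0)) (ht : 0 ≤ t)
    (ψ : DomA T) : IntervalIntegrable (fun s => adjA (y s) ψ) volume 0 t := by
  refine ContinuousOn.intervalIntegrable ?_
  rw [uIcc_of_le ht]
  exact (hy.mono Icc_subset_Ici_self).inner continuousOn_const

theorem MemL2Loc.intervalIntegrable_adjB (hj : MemL2Loc j) (ht : 0 ≤ t) (ψ : DomA T) :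
    IntervalIntegrable (fun s => adjB (j s) ψ) volume 0 t :=
  (hj.intervalIntegrable ht).mul_const _

theorem IsStatePath.snd_ae_eq_window {R : ℝ} {y : ℝ → StateSpace T} (hy : IsStatePath ι j y)
    (ht : t ∈ Icc 0 R) :
    (y t).snd =ᵐ[histMeasure T] fun s => -truncatedInvestment ι j R (t - T - s) := by
  filter_upwards [(hy t ht.1).2, ae_restrict_mem measurableSet_Ioo] with s hs hsT
  rw [hs, truncatedInvestment_eq_investment
    ⟨by linarith [hsT.2, ht.1], by linarith [hsT.1, ht.2]⟩]

theorem IsStatePath.inner_val (hT : 0 ≤ T) (hj : MemL2Loc j) {y : ℝ → StateSpace T}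
    (hy : IsStatePath ι j y) {R : ℝ} (ht : t ∈ Icc 0 R) (ψ : DomA T) :
    inner ℝ (y t) ψ.val =
      ∫ r in Ioo (-T) 0, ψ.der r * ∫ s in (t - T - r)..t, truncatedInvestment ι j R s := by
  rw [← integral_window_mul_rep_sub hT ψ (integrable_truncatedInvestment hj), DomA.inner_val,
    (hy t ht.1).1, capital_eq_integral_window hT hj ht,
    sub_eq_add_neg (_ * _), ← integral_neg]
  refine congrArg _ (integral_congr_ae ((hy.snd_ae_eq_window ht).mono fun s hs => ?_))
  simp only [hs, neg_mul]

theorem IsStatePath.integral_adjA (hj : MemL2Loc j) {y : ℝ → StateSpace T}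
    (hy : IsStatePath ι j y) (ht : 0 ≤ t) (ψ : DomA T) :
    ∫ τ in (0 : ℝ)..t, adjA (y τ) ψ = -∫ r in Ioo (-T) 0,
      ψ.der r * ∫ s in (-T - r)..(t - T - r), truncatedInvestment ι j t s := by
  have h_adjA (τ : ℝ) (hτ : τ ∈ uIcc 0 t) : adjA (y τ) ψ =
      -∫ s in Ioo (-T) 0, truncatedInvestment ι j t (τ - s - T) * ψ.der s := by
    rw [uIcc_of_le ht] at hτ
    rw [adjA_eq_integral, ← integral_neg]
    refine integral_congr_ae ((hy.snd_ae_eq_window hτ).mono fun s hs => ?_)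
    simp only [hs, neg_mul, sub_right_comm τ T s]
  rw [intervalIntegral.integral_congr h_adjA, intervalIntegral.integral_neg,
    integral_integral_comp_sub_mul
      (f := fun s => truncatedInvestment ι j t (s - T))
      ((integrable_truncatedInvestment hj).comp_sub_right T) ψ.der.integrableOn]
  simp only [intervalIntegral.integral_comp_sub_right, zero_sub, sub_right_comm _ _ T, neg_sub_comm]

theorem integral_adjB_eq (hT : 0 ≤ T) (ht : 0 ≤ t) (ψ : DomA T) :
    ∫ τ in (0 : ℝ)..t, adjB (j τ) ψ =
      ∫ r in Ioo (-T) 0, ψ.der r * ∫ s in (0 : ℝ)..t, truncatedInvestment ι j t s := by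
  have h_control : ∫ s in (0 : ℝ)..t, j s = ∫ s in (0 : ℝ)..t, truncatedInvestment ι j t s := by
    refine intervalIntegral.integral_congr fun s hs => ?_
    rw [uIcc_of_le ht] at hs
    simp [truncatedInvestment, hs.1, hs.2, not_lt.2 hs.1]
  simp only [adjB]
  rw [intervalIntegral.integral_mul_const, integral_mul_const, h_control, ψ.opB_eq_integral hT,
    mul_comm]

theorem IsStatePath.isControlledSolution (hT : 0 ≤ T) (hj : MemL2Loc j) {y : ℝ → StateSpace T}
    (hy : IsStatePath ι j y) (hyc : ContinuousOn y (Ici 0)) :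
    IsControlledSolution (initialState ι) j y := by
  refine ⟨hyc, hy.apply_zero, fun ψ t ht => ?_⟩
  have hE (a b : ℝ) : IntervalIntegrable (truncatedInvestment ι j t) volume a b :=
    (integrable_truncatedInvestment hj).intervalIntegrable
  set P : ℝ → ℝ := fun x => ∫ s in (0 : ℝ)..x, truncatedInvestment ι j t s
  have hPc : Continuous P := intervalIntegral.continuous_primitive hE 0
  have hP (a b : ℝ) : ∫ s in a..b, truncatedInvestment ι j t s = P b - P a :=
    (intervalIntegral.integral_interval_sub_left (hE _ _) (hE _ _)).symm
  have h_der {g : ℝ → ℝ} (hg : Continuous g) :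
      Integrable (fun r => ψ.der r * g r) (histMeasure T) :=
    (intervalIntegrable_iff_integrableOn_Ioo_of_le (neg_nonpos.2 hT)).1
      ((ψ.der.intervalIntegrable hT).mul_continuousOn hg.continuousOn)
  rw [intervalIntegral.integral_add (intervalIntegrable_adjA hyc ht ψ)
      (hj.intervalIntegrable_adjB ht ψ), hy.integral_adjA hj ht,
    integral_adjB_eq (ι := ι) hT ht, ← hy.apply_zero, hy.inner_val hT hj ⟨ht, le_rfl⟩,
    hy.inner_val hT hj ⟨le_rfl, ht⟩]
  simp only [hP]
  have h_start : Integrable (fun r => ψ.der r * (P 0 - P (0 - T - r))) (histMeasure T) :=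
    h_der (by fun_prop)
  have h_flow : Integrable (fun r => ψ.der r * (P t - P 0)) (histMeasure T) :=
    h_der continuous_const
  have h_delayed : Integrable (fun r => ψ.der r * (P (t - T - r) - P (-T - r))) (histMeasure T) :=
    h_der (by fun_prop)
  have h_diff : Integrable (fun r => ψ.der r * (P t - P 0) -
      ψ.der r * (P (t - T - r) - P (-T - r))) (histMeasure T) := h_flow.sub h_delayed
  rw [neg_add_eq_sub, ← integral_sub h_flow h_delayed, ← integral_add h_start h_diff]
  refine integral_congr_ae (.of_forall fun r => ?_)
  simp only [zero_sub]
  ring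

end ControlledEquation

section SmoothHistories

variable {T : ℝ}

theorem memLp_histMeasure {g : ℝ → ℝ} (hg : Continuous g) (T : ℝ) :
    MemLp g 2 (histMeasure T) := by
  obtain ⟨C, hC⟩ := isCompact_Icc.exists_bound_of_continuousOn (hg.continuousOn (s := Icc (-T) 0))
  refine MemLp.of_bound hg.aestronglyMeasurable C ?_
  filter_upwards [ae_restrict_mem measurableSet_Ioo] with s hs
  exact hC s (Ioo_subset_Icc_self hs)

/-- The class in `L²(-T, 0)` of a continuous function on `ℝ`. -/
noncomputable def histClass (T : ℝ) (g : ℝ → ℝ) (hg : Continuous g) : L2Hist T :=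
  (memLp_histMeasure hg T).toLp g

theorem coeFn_histClass {g : ℝ → ℝ} (hg : Continuous g) :
    histClass T g hg =ᵐ[histMeasure T] g :=
  MemLp.coeFn_toLp _

theorem inner_histClass (z : L2Hist T) {g : ℝ → ℝ} (hg : Continuous g) :
    inner ℝ z (histClass T g hg) = ∫ s in Ioo (-T) 0, z s * g s := by
  rw [L2.inner_def]
  refine integral_congr_ae ((coeFn_histClass hg).mono fun s hs => ?_)
  simp only [hs, RCLike.inner_apply, conj_trivial, mul_comm]

theorem norm_histClass_le {g : ℝ → ℝ} (hg : Continuous g) {C : ℝ} (hC0 : 0 ≤ C)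
    (hC : ∀ s, |g s| ≤ C) :
    ‖histClass T g hg‖ ≤ ((measureUnivNNReal (histMeasure T) : ℝ) ^ (2 : ℝ≥0∞).toReal⁻¹) * C :=
  Lp.norm_le_of_ae_bound hC0 ((coeFn_histClass hg).mono fun s hs => hs ▸ hC s)

theorem eq_zero_of_forall_inner_histClass_eq_zero {z : L2Hist T}
    (h : ∀ g : ℝ → ℝ, (hg : ContDiff ℝ ∞ g) → HasCompactSupport g → tsupport g ⊆ Ioo (-T) 0 →
      inner ℝ z (histClass T g hg.continuous) = 0) : z = 0 := by
  have h_ae : ∀ᵐ s, s ∈ Ioo (-T) 0 → z s = 0 := by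
    refine isOpen_Ioo.ae_eq_zero_of_integral_contDiff_smul_eq_zero
      z.integrableOn.locallyIntegrableOn fun g hg hgc hgs => ?_
    rw [← h g hg hgc hgs, inner_histClass,
      ← setIntegral_eq_integral_of_forall_compl_eq_zero (s := Ioo (-T) 0)]
    · simp only [smul_eq_mul, mul_comm]
    · intro s hs
      rw [image_eq_zero_of_notMem_tsupport fun hgs' => hs (hgs hgs'), zero_smul]
  refine Lp.ext ?_
  filter_upwards [(ae_restrict_iff' measurableSet_Ioo).2 h_ae, Lp.coeFn_zero ℝ 2 (histMeasure T)]
    with s hs h0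
  rw [hs, h0, Pi.zero_apply]

/-- The element `(g(0), g)` of `D(𝒜)` given by a `C¹` function `g`. -/
noncomputable def DomA.ofContDiff (T : ℝ) (g : ℝ → ℝ) (hg : ContDiff ℝ 1 g) : DomA T where
  val := WithLp.toLp 2 (g 0, histClass T g hg.continuous)
  rep := g
  der := histClass T (deriv g) hg.continuous_deriv_one
  snd_ae_eq := coeFn_histClass hg.continuous
  rep_eq s hs := by
    have h_der : ∫ r in s..0, histClass T (deriv g) hg.continuous_deriv_one r =
        ∫ r in s..0, deriv g r := by
      rw [intervalIntegral.integral_of_le hs.2, intervalIntegral.integral_of_le hs.2,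
        integral_Ioc_eq_integral_Ioo, integral_Ioc_eq_integral_Ioo]
      exact integral_congr_ae (ae_restrict_of_ae_restrict_of_subset (Ioo_subset_Ioo_left hs.1)
        (coeFn_histClass hg.continuous_deriv_one))
    rw [h_der, intervalIntegral.integral_deriv_eq_sub
      (fun x _ => hg.differentiable one_ne_zero x)
      (hg.continuous_deriv_one.intervalIntegrable _ _), sub_sub_cancel]
  fst_eq := rfl

theorem inner_ofContDiff_val (x : StateSpace T) {g : ℝ → ℝ} (hg : ContDiff ℝ 1 g) :
    inner ℝ x (DomA.ofContDiff T g hg).val =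
      x.fst * g 0 + inner ℝ x.snd (histClass T g hg.continuous) := by
  rw [DomA.inner_val, inner_histClass]
  rfl

theorem adjA_ofContDiff (x : StateSpace T) {g : ℝ → ℝ} (hg : ContDiff ℝ 1 g) :
    adjA x (DomA.ofContDiff T g hg) =
      inner ℝ x.snd (histClass T (deriv g) hg.continuous_deriv_one) := by
  rw [adjA, WithLp.prod_inner_apply]
  simp [DomA.ofContDiff, DomA.opA]

end SmoothHistories

section Uniqueness

variable {T : ℝ}

theorem continuous_state_fst : Continuous fun x : StateSpace T => x.fst :=
  continuous_fst.comp (WithLp.prod_continuous_ofLp 2 ℝ (L2Hist T))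

theorem continuous_state_snd : Continuous fun x : StateSpace T => x.snd :=
  continuous_snd.comp (WithLp.prod_continuous_ofLp 2 ℝ (L2Hist T))

theorem abs_sub_sub_mul_deriv_le_of_lipschitz {g : ℝ → ℝ} {C : NNReal} (hg : Differentiable ℝ g)
    (hC : LipschitzWith C (deriv g)) (x h : ℝ) :
    |g (x + h) - g x - h * deriv g x| ≤ C * h ^ 2 := by
  have h_bound (u : ℝ) (hu : u ∈ uIcc x (x + h)) :
      ‖deriv g u - deriv g x‖ ≤ C * |h| := by
    have h_dist := hC.dist_le_mul u x
    have h_le : |u - x| ≤ |h| := by simpa using abs_sub_left_of_mem_uIcc hu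
    rw [Real.dist_eq, Real.dist_eq] at h_dist
    exact h_dist.trans (by gcongr)
  have h_mean := (convex_uIcc x (x + h)).norm_image_sub_le_of_norm_hasDerivWithin_le
    (f := fun u => g u - u * deriv g x)
    (fun u _ => ((hg u).hasDerivAt.sub (hasDerivAt_mul_const (deriv g x))).hasDerivWithinAt)
    h_bound left_mem_uIcc right_mem_uIcc
  calc |g (x + h) - g x - h * deriv g x|
      = ‖g (x + h) - (x + h) * deriv g x - (g x - x * deriv g x)‖ := by
        rw [Real.norm_eq_abs]; ring_nf
    _ ≤ C * |h| * ‖x + h - x‖ := h_mean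
    _ = C * h ^ 2 := by rw [add_sub_cancel_left, Real.norm_eq_abs, mul_assoc, ← sq, sq_abs]

theorem hasDerivAt_histClass_translate (T : ℝ) {g : ℝ → ℝ} {C : NNReal} (hg : ContDiff ℝ 1 g)
    (hC : LipschitzWith C (deriv g)) (r : ℝ) :
    HasDerivAt
      (fun r => histClass T (fun s => g (s + r)) (hg.continuous.comp (continuous_add_const r)))
      (histClass T (fun s => deriv g (s + r))
        (hg.continuous_deriv_one.comp (continuous_add_const r))) r := by
  have hgc := hg.continuous
  have := hg.continuous_deriv_one
  rw [hasDerivAt_iff_isLittleO_nhds_zero]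
  refine Asymptotics.IsBigO.trans_isLittleO (g := fun h : ℝ => h ^ 2) ?_
    (by simpa using Asymptotics.isLittleO_pow_id (𝕜 := ℝ) one_lt_two)
  refine Asymptotics.IsBigO.of_bound
    ((measureUnivNNReal (histMeasure T) : ℝ) ^ (2 : ℝ≥0∞).toReal⁻¹ * C) (.of_forall fun h => ?_)
  rw [norm_pow, Real.norm_eq_abs, sq_abs, mul_assoc]
  refine norm_histClass_le (g := fun s => g (s + (r + h)) - g (s + r) - h * deriv g (s + r))
    (by fun_prop) (by positivity) fun s => ?_
  rw [← add_assoc]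
  exact abs_sub_sub_mul_deriv_le_of_lipschitz (hg.differentiable one_ne_zero) hC (s + r) h

/-- `d` solves `d' = 𝒜^* d`, `d(0) = 0`, in `D(𝒜)'`. -/
def IsHomogeneousSolution (d : ℝ → StateSpace T) : Prop :=
  ContinuousOn d (Ici 0) ∧ ∀ ψ : DomA T, ∀ t : ℝ, 0 ≤ t →
    inner ℝ (d t) ψ.val = ∫ s in (0 : ℝ)..t, adjA (d s) ψ

theorem IsControlledSolution.sub {x : StateSpace T} {u : ℝ → ℝ} {y z : ℝ → StateSpace T}
    (hy : IsControlledSolution x u y) (hz : IsControlledSolution x u z) (hu : MemL2Loc u) :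
    IsHomogeneousSolution (y - z) := by
  refine ⟨hy.1.sub hz.1, fun ψ t ht => ?_⟩
  have h_int {v : ℝ → StateSpace T} (hv : ContinuousOn v (Ici 0)) :
      IntervalIntegrable (fun s => adjA (v s) ψ + adjB (u s) ψ) volume 0 t :=
    (intervalIntegrable_adjA hv ht ψ).add (hu.intervalIntegrable_adjB ht ψ)
  rw [Pi.sub_apply, inner_sub_left, hy.2.2 ψ t ht, hz.2.2 ψ t ht, add_sub_add_left_eq_sub,
    ← intervalIntegral.integral_sub (h_int hy.1) (h_int hz.1)]
  simp only [adjA, Pi.sub_apply, inner_sub_left, add_sub_add_right_eq_sub]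

theorem IsHomogeneousSolution.inner_integral_snd_eq_zero {d : ℝ → StateSpace T}
    (hd : IsHomogeneousSolution d) (hdc : Continuous d) {g : ℝ → ℝ} (hg : ContDiff ℝ ∞ g)
    (hgc : HasCompactSupport g) (hgs : tsupport g ⊆ Ioo (-T) 0) {t : ℝ} (ht : 0 ≤ t) :
    inner ℝ (∫ s in (0 : ℝ)..t, (d s).snd) (histClass T g hg.continuous) = 0 := by
  have hg1 : ContDiff ℝ 1 g := hg.of_le (by exact_mod_cast le_top)
  have hg2 : ContDiff ℝ 1 (deriv g) :=
    (contDiff_infty_iff_deriv.1 hg).2.of_le (by exact_mod_cast le_top)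
  obtain ⟨C, hC⟩ := hg2.lipschitzWith_of_hasCompactSupport hgc.deriv one_ne_zero
  have h_snd : Continuous fun s => (d s).snd := continuous_state_snd.comp hdc
  let H (τ : ℝ) : ℝ := inner ℝ (∫ s in (0 : ℝ)..τ, (d s).snd)
    (histClass T (fun s => g (s + (t - τ))) (hg.continuous.comp (continuous_add_const _)))
  have h_deriv (τ : ℝ) : HasDerivAt H _ τ :=
    (h_snd.integral_hasStrictDerivAt 0 τ).hasDerivAt.inner ℝ
      ((hasDerivAt_histClass_translate T hg1 hC (t - τ)).scomp τ ((hasDerivAt_id τ).const_sub t))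
  have h_zero (τ : ℝ) (hτ : τ ∈ Ico 0 t) : HasDerivAt H 0 τ := by
    convert h_deriv τ using 1
    have h_boundary : g (t - τ) = 0 :=
      image_eq_zero_of_notMem_tsupport fun h => by linarith [(hgs h).2, hτ.2]
    have h_shift : deriv (fun s => g (s + (t - τ))) = fun s => deriv g (s + (t - τ)) :=
      funext fun s => deriv_comp_add_const g (t - τ) s
    have h_weak := hd.2 (DomA.ofContDiff T (fun s => g (s + (t - τ))) (by fun_prop)) τ hτ.1
    simp only [inner_ofContDiff_val, adjA_ofContDiff, h_shift, zero_add, h_boundary, mul_zero]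
      at h_weak
    have h_swap (z : L2Hist T) :
        ∫ s in (0 : ℝ)..τ, inner ℝ (d s).snd z = inner ℝ (∫ s in (0 : ℝ)..τ, (d s).snd) z := by
      simp only [real_inner_comm z]
      exact (innerSL ℝ z).intervalIntegral_comp_comm (h_snd.intervalIntegrable 0 τ)
    rw [h_weak, h_swap, neg_one_smul, inner_neg_right, neg_add_cancel]
  have h_const := constant_of_has_deriv_right_zero (f := H)
    (fun τ _ => (h_deriv τ).continuousAt.continuousWithinAt)
    (fun τ hτ => (h_zero τ hτ).hasDerivWithinAt) t ⟨ht, le_rfl⟩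
  simpa [H] using h_const

theorem IsHomogeneousSolution.eq_zero {d : ℝ → StateSpace T} (hd : IsHomogeneousSolution d)
    {t : ℝ} (ht : 0 ≤ t) : d t = 0 := by
  have h_ext : Continuous fun s => d (max s 0) :=
    hd.1.comp_continuous (by fun_prop) fun s => le_max_right s 0
  have h_hom : IsHomogeneousSolution fun s => d (max s 0) := by
    refine ⟨h_ext.continuousOn, fun ψ t ht => ?_⟩
    simp only [max_eq_left ht, hd.2 ψ t ht]
    refine intervalIntegral.integral_congr fun s hs => ?_
    rw [uIcc_of_le ht] at hs
    simp only [max_eq_left hs.1]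
  have h_snd (t : ℝ) (ht : 0 ≤ t) : (d t).snd = 0 := by
    have h_zero := eq_zero_of_integral_eq_zero (continuous_state_snd.comp h_ext).continuousOn
      (fun r hr => eq_zero_of_forall_inner_histClass_eq_zero fun g hg hgc hgs =>
        h_hom.inner_integral_snd_eq_zero h_ext hg hgc hgs hr) ht
    simpa only [Function.comp_apply, max_eq_left ht] using h_zero
  have h_fst : (d t).fst = 0 := by
    have h_const := hd.2 (DomA.ofContDiff T (fun _ => 1) contDiff_const) t ht
    rw [inner_ofContDiff_val, h_snd t ht, inner_zero_left, add_zero, mul_one] at h_const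
    rw [h_const]
    refine intervalIntegral.integral_zero_ae (.of_forall fun s hs => ?_)
    rw [uIoc_of_le ht] at hs
    rw [adjA_ofContDiff, h_snd s hs.1.le, inner_zero_left]
  exact WithLp.ofLp_injective 2 (Prod.ext h_fst (h_snd t ht))

theorem IsControlledSolution.isStatePath (hT : 0 ≤ T) {ι : L2Hist T} {j : ℝ → ℝ}
    {y : ℝ → StateSpace T} (hj : MemL2Loc j) (hy : IsControlledSolution (initialState ι) j y) :
    IsStatePath ι j y := by
  obtain ⟨z, hzc, hz⟩ := exists_isStatePath hT (ι := ι) hj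
  intro t ht
  have h_eq : y t = z t :=
    sub_eq_zero.1 ((hy.sub (hz.isControlledSolution hT hj hzc) hj).eq_zero ht)
  exact h_eq ▸ hz t ht

end Uniqueness

section EquivalentCapital

variable {T A ξ : ℝ}

/-- The element `(1, e^{ξ s})` of `D(𝒜)`, which represents the equivalent capital `Γ₀`. -/
noncomputable def DomA.exp (T ξ : ℝ) : DomA T :=
  DomA.ofContDiff T (fun s => Real.exp (ξ * s)) (by fun_prop)

theorem Gamma0_eq_inner_exp (ξ : ℝ) (x : StateSpace T) :
    Gamma0 ξ x = inner ℝ x (DomA.exp T ξ).val := by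
  rw [DomA.exp, inner_ofContDiff_val, inner_histClass, Gamma0, mul_zero, Real.exp_zero, mul_one]
  simp only [mul_comm]

theorem continuous_Gamma0 (ξ : ℝ) : Continuous (Gamma0 (T := T) ξ) := by
  simp only [funext (Gamma0_eq_inner_exp (T := T) ξ)]
  fun_prop

theorem adjA_exp (ξ : ℝ) (x : StateSpace T) :
    adjA x (DomA.exp T ξ) = ξ * (Gamma0 ξ x - x.fst) := by
  have h_deriv : deriv (fun s => Real.exp (ξ * s)) = fun s => ξ * Real.exp (ξ * s) :=
    funext fun s => by simpa [mul_comm] using ((hasDerivAt_id s).const_mul ξ).exp.deriv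
  rw [DomA.exp, adjA_ofContDiff, inner_histClass, Gamma0, add_sub_cancel_left, h_deriv,
    ← integral_const_mul]
  exact congrArg _ (funext fun s => by ring)

theorem adjB_exp (hA : A ≠ 0) (hξ_root : ξ = A * (1 - Real.exp (-ξ * T))) (u : ℝ) :
    adjB u (DomA.exp T ξ) = ξ / A * u := by
  have h_opB : (DomA.exp T ξ).opB = 1 - Real.exp (-ξ * T) := by
    simp [DomA.exp, DomA.opB, DomA.ofContDiff]
  rw [adjB, h_opB, mul_comm, (eq_div_iff hA).2 ((mul_comm _ _).trans hξ_root.symm)]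

theorem IsControlledSolution.Gamma0_eq (hA : A ≠ 0) (hξ_root : ξ = A * (1 - Real.exp (-ξ * T)))
    {x : StateSpace T} {u : ℝ → ℝ} {y : ℝ → StateSpace T} (hy : IsControlledSolution x u y)
    {t : ℝ} (ht : 0 ≤ t) :
    Gamma0 ξ (y t) = Gamma0 ξ (y 0) +
      ∫ s in (0 : ℝ)..t, (ξ * Gamma0 ξ (y s) - ξ / A * (A * (y s).fst - u s)) := by
  rw [Gamma0_eq_inner_exp, hy.2.2 _ t ht, hy.2.1, ← Gamma0_eq_inner_exp]
  refine congrArg _ (intervalIntegral.integral_congr fun s _ => ?_)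
  simp only [adjA_exp, adjB_exp hA hξ_root]
  field_simp
  ring

theorem intervalIntegrable_Gamma0 (ξ : ℝ) {y : ℝ → StateSpace T} (hy : ContinuousOn y (Ici 0))
    {t : ℝ} (ht : 0 ≤ t) : IntervalIntegrable (fun s => Gamma0 ξ (y s)) volume 0 t := by
  refine ContinuousOn.intervalIntegrable ?_
  rw [uIcc_of_le ht]
  exact (continuous_Gamma0 ξ).comp_continuousOn (hy.mono Icc_subset_Ici_self)

/-- The states `(k, F(i))` with nonnegative past investment `i` and capital `k = ∫ i`. -/
def IsInvestmentState (x : StateSpace T) : Prop :=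
  x.fst = -∫ s in Ioo (-T) 0, x.snd s ∧ ∀ᵐ s ∂histMeasure T, x.snd s ≤ 0

theorem integrable_exp_mul_hist (ξ : ℝ) (z : L2Hist T) :
    Integrable (fun s => Real.exp (ξ * s) * z s) (histMeasure T) :=
  (memLp_histMeasure (by fun_prop : Continuous fun s => Real.exp (ξ * s)) T).integrable_mul
    (Lp.memLp z)

theorem IsInvestmentState.Gamma0_eq_integral {x : StateSpace T} (hx : IsInvestmentState x)
    (ξ : ℝ) : Gamma0 ξ x = ∫ s in Ioo (-T) 0, (1 - Real.exp (ξ * s)) * -x.snd s := by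
  simp only [mul_neg, sub_mul, one_mul, neg_sub]
  rw [integral_sub (integrable_exp_mul_hist ξ x.snd) x.snd.integrableOn, Gamma0, hx.1]
  ring

theorem IsInvestmentState.Gamma0_nonneg {x : StateSpace T} (hx : IsInvestmentState x)
    (hξ : 0 ≤ ξ) : 0 ≤ Gamma0 ξ x := by
  rw [hx.Gamma0_eq_integral]
  refine integral_nonneg_of_ae ?_
  filter_upwards [hx.2, ae_restrict_mem measurableSet_Ioo] with s hs hsT
  have h_exp := Real.exp_le_one_iff.2 (mul_nonpos_of_nonneg_of_nonpos hξ hsT.2.le)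
  exact mul_nonneg (sub_nonneg.2 h_exp) (neg_nonneg.2 hs)

theorem IsInvestmentState.Gamma0_pos {x : StateSpace T} (hx : IsInvestmentState x)
    (hξ : 0 < ξ) (hx0 : 0 < x.fst) : 0 < Gamma0 ξ x := by
  have h_exp (s : ℝ) (hs : s ∈ Ioo (-T) 0) : Real.exp (ξ * s) < 1 :=
    Real.exp_lt_one_iff.2 (mul_neg_of_pos_of_neg hξ hs.2)
  refine (hx.Gamma0_nonneg hξ.le).lt_of_ne fun h_zero => hx0.ne' ?_
  rw [hx.Gamma0_eq_integral, eq_comm, integral_eq_zero_iff_of_nonneg_ae] at h_zero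
  · rw [hx.1, neg_eq_zero]
    refine integral_eq_zero_of_ae ?_
    filter_upwards [h_zero, ae_restrict_mem measurableSet_Ioo] with s hs hsT
    exact neg_eq_zero.1 ((mul_eq_zero.1 hs).resolve_left (sub_pos.2 (h_exp s hsT)).ne')
  · filter_upwards [hx.2, ae_restrict_mem measurableSet_Ioo] with s hs hsT
    exact mul_nonneg (sub_pos.2 (h_exp s hsT)).le (neg_nonneg.2 hs)
  · simpa only [mul_neg, sub_mul, one_mul, neg_sub] using!
      (integrable_exp_mul_hist ξ x.snd).sub x.snd.integrableOn

theorem IsInvestmentState.mul_Gamma0_le {x : StateSpace T} (hx : IsInvestmentState x)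
    (hξ : 0 ≤ ξ) (hA : 0 ≤ A) (hξ_root : ξ = A * (1 - Real.exp (-ξ * T))) :
    A * Gamma0 ξ x ≤ ξ * x.fst := by
  nth_rw 2 [hξ_root]
  rw [mul_assoc, hx.1, ← integral_neg, ← integral_const_mul, hx.Gamma0_eq_integral]
  refine mul_le_mul_of_nonneg_left (integral_mono_ae ?_ ?_ ?_) hA
  · simpa only [mul_neg, sub_mul, one_mul, neg_sub] using!
      (integrable_exp_mul_hist ξ x.snd).sub x.snd.integrableOn
  · exact x.snd.integrableOn.neg.const_mul _
  · filter_upwards [hx.2, ae_restrict_mem measurableSet_Ioo] with s hs hsT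
    have h_exp : Real.exp (-ξ * T) ≤ Real.exp (ξ * s) :=
      Real.exp_le_exp.2 (by nlinarith [hsT.1])
    exact mul_le_mul_of_nonneg_right (sub_le_sub_left h_exp 1) (neg_nonneg.2 hs)

theorem IsStatePath.isInvestmentState (hT : 0 ≤ T) {ι : L2Hist T}
    (hι : ∀ᵐ s ∂histMeasure T, 0 ≤ ι s) {j : ℝ → ℝ} (hj : MemL2Loc j) {y : ℝ → StateSpace T}
    (hy : IsStatePath ι j y) {t : ℝ} (ht : 0 ≤ t) (hj0 : ∀ s ∈ Ico 0 t, 0 ≤ j s) :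
    IsInvestmentState (y t) := by
  refine ⟨?_, ?_⟩
  · rw [integral_congr_ae (hy.snd_ae_eq_window ⟨ht, le_rfl⟩), integral_neg, neg_neg,
      setIntegral_hist_eq hT, intervalIntegral.integral_comp_sub_left, (hy t ht).1,
      capital_eq_integral_window hT hj ⟨ht, le_rfl⟩, sub_zero, sub_neg_eq_add, sub_add_cancel]
  · have h_past := (Measure.measurePreserving_sub_left volume (t - T)).quasiMeasurePreserving.ae
      ((ae_restrict_iff' measurableSet_Ioo).1 hι)
    filter_upwards [(hy t ht).2, ae_restrict_of_ae h_past, ae_restrict_mem measurableSet_Ioo]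
      with s hs h_past hsT
    rw [hs, neg_nonpos, investment]
    split_ifs with h_neg
    · exact h_past ⟨by linarith [hsT.2], h_neg⟩
    · exact hj0 _ ⟨not_lt.1 h_neg, by linarith [hsT.1]⟩

end EquivalentCapital

section Budget

variable {T A ξ : ℝ} {ι : L2Hist T}

theorem MemL2Loc.intervalIntegrable_consumption (hT : 0 ≤ T) {j : ℝ → ℝ} (hj : MemL2Loc j)
    (A : ℝ) {t : ℝ} (ht : 0 ≤ t) :
    IntervalIntegrable (fun s => A * capital ι j s - j s) volume 0 t := by
  refine ((ContinuousOn.intervalIntegrable ?_).const_mul A).sub (hj.intervalIntegrable ht)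
  rw [uIcc_of_le ht]
  exact (continuousOn_capital hT hj).mono Icc_subset_Ici_self

theorem IsStatePath.exp_neg_mul_Gamma0 (hT : 0 ≤ T) (hA : A ≠ 0)
    (hξ_root : ξ = A * (1 - Real.exp (-ξ * T))) {j : ℝ → ℝ} (hj : MemL2Loc j)
    {y : ℝ → StateSpace T} (hy : IsStatePath ι j y) (hyc : ContinuousOn y (Ici 0)) {t : ℝ}
    (ht : 0 ≤ t) :
    Real.exp (-ξ * t) * Gamma0 ξ (y t) = Gamma0 ξ (initialState ι) -
      ∫ s in (0 : ℝ)..t, Real.exp (-ξ * s) * (ξ / A * (A * capital ι j s - j s)) := by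
  rw [← hy.apply_zero]
  refine exp_neg_mul_eq_sub_of_integral_eq (intervalIntegrable_Gamma0 ξ hyc ht)
    ((hj.intervalIntegrable_consumption hT A ht).const_mul _) fun s hs => ?_
  rw [uIcc_of_le ht] at hs
  rw [(hy.isControlledSolution hT hj hyc).Gamma0_eq hA hξ_root hs.1]
  refine congrArg _ (intervalIntegral.integral_congr fun r hr => ?_)
  rw [uIcc_of_le hs.1] at hr
  simp only [(hy r hr.1).1]

theorem integrableOn_and_integral_consumption_le_of_admissible (hT : 0 ≤ T) (hA : 0 < A)
    (hξ : 0 < ξ) (hξ_root : ξ = A * (1 - Real.exp (-ξ * T)))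
    (hι : ∀ᵐ s ∂histMeasure T, 0 ≤ ι s) {j : ℝ → ℝ} (hj : j ∈ admissible A ι) :
    IntegrableOn (fun t => Real.exp (-ξ * t) * (A * capital ι j t - j t)) (Ioi 0) ∧
      ∫ t in Ioi (0 : ℝ), Real.exp (-ξ * t) * (A * capital ι j t - j t) ≤
        A / ξ * Gamma0 ξ (initialState ι) := by
  have hj2 : MemL2Loc j := hj.1
  obtain ⟨y, hyc, hy⟩ := exists_isStatePath (ι := ι) hT hj2
  refine integrableOn_Ioi_and_integral_le_of_bounded (fun t ht => ?_) (fun t ht => ?_)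
    fun t ht => ?_
  · exact mul_nonneg (Real.exp_pos _).le (sub_nonneg.2 (hj.2 t ht).2)
  · exact (hj2.intervalIntegrable_consumption hT A ht).continuousOn_mul (by fun_prop)
  · have h_nonneg : 0 ≤ Real.exp (-ξ * t) * Gamma0 ξ (y t) := mul_nonneg (Real.exp_pos _).le
      ((hy.isInvestmentState hT hι hj2 ht fun s hs => (hj.2 s hs.1).1).Gamma0_nonneg hξ.le)
    rw [hy.exp_neg_mul_Gamma0 hT hA.ne' hξ_root hj2 hyc ht] at h_nonneg
    simp only [mul_left_comm _ (ξ / A), intervalIntegral.integral_const_mul] at h_nonneg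
    rwa [← inv_div, inv_mul_eq_div, le_div_iff₀' (by positivity), ← sub_nonneg]

end Budget

section ClosedLoop

variable {T A ξ θ : ℝ} {ι : L2Hist T}

/-- The feedback which consumes `θ A Γ₀ / ξ` out of the output `A x⁰`. The map `φ` is the case
`θ = (ρ - ξ(1-σ))/σ`. -/
noncomputable def linearFeedback (A ξ θ : ℝ) (x : StateSpace T) : ℝ :=
  A * x.fst - θ * (A / ξ) * Gamma0 ξ x

theorem continuous_linearFeedback (A ξ θ : ℝ) :
    Continuous (linearFeedback (T := T) A ξ θ) :=
  (continuous_const.mul continuous_state_fst).sub (continuous_const.mul (continuous_Gamma0 ξ))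

theorem IsInvestmentState.linearFeedback_pos (hA : 0 < A) (hξ : 0 < ξ)
    (hξ_root : ξ = A * (1 - Real.exp (-ξ * T))) (hθ : 0 ≤ θ) (hθA : θ < A) {x : StateSpace T}
    (hx : IsInvestmentState x) (hΓ : 0 < Gamma0 ξ x) : 0 < linearFeedback A ξ θ x := by
  have h_le := hx.mul_Gamma0_le hξ.le hA.le hξ_root
  have h_fst : 0 < x.fst := pos_of_mul_pos_right ((mul_pos hA hΓ).trans_le h_le) hξ.le
  rw [linearFeedback, sub_pos]
  calc θ * (A / ξ) * Gamma0 ξ x = θ * (A * Gamma0 ξ x / ξ) := by ring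
    _ ≤ θ * x.fst := by gcongr; exact (div_le_iff₀' hξ).2 h_le
    _ < A * x.fst := by gcongr

theorem IsClosedLoopSolution.memL2Loc {x : StateSpace T} {y : ℝ → StateSpace T}
    (hy : IsClosedLoopSolution (linearFeedback A ξ θ) x y) :
    MemL2Loc fun t => linearFeedback A ξ θ (y t) :=
  .of_continuousOn ((continuous_linearFeedback A ξ θ).comp_continuousOn hy.1)

theorem IsClosedLoopSolution.isStatePath (hT : 0 ≤ T) {y : ℝ → StateSpace T}
    (hy : IsClosedLoopSolution (linearFeedback A ξ θ) (initialState ι) y) :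
    IsStatePath ι (fun t => linearFeedback A ξ θ (y t)) y :=
  IsControlledSolution.isStatePath hT hy.memL2Loc hy

theorem IsClosedLoopSolution.Gamma0_eq_mul_exp (hA : A ≠ 0) (hξ : ξ ≠ 0)
    (hξ_root : ξ = A * (1 - Real.exp (-ξ * T))) {x : StateSpace T} {y : ℝ → StateSpace T}
    (hy : IsClosedLoopSolution (linearFeedback A ξ θ) x y) {t : ℝ} (ht : 0 ≤ t) :
    Gamma0 ξ (y t) = Gamma0 ξ x * Real.exp ((ξ - θ) * t) := by
  rw [← hy.2.1]
  refine eq_exp_mul_of_integral_eq (G := fun t => Gamma0 ξ (y t))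
    (intervalIntegrable_Gamma0 ξ hy.1 ht) fun s hs => ?_
  rw [uIcc_of_le ht] at hs
  rw [IsControlledSolution.Gamma0_eq hA hξ_root hy hs.1]
  refine congrArg _ (intervalIntegral.integral_congr fun r _ => ?_)
  simp only [linearFeedback]
  field_simp
  ring

theorem IsClosedLoopSolution.consumption_eq (hT : 0 ≤ T) (hA : A ≠ 0) (hξ : ξ ≠ 0)
    (hξ_root : ξ = A * (1 - Real.exp (-ξ * T))) {y : ℝ → StateSpace T}
    (hy : IsClosedLoopSolution (linearFeedback A ξ θ) (initialState ι) y) {t : ℝ} (ht : 0 ≤ t) :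
    A * capital ι (fun t => linearFeedback A ξ θ (y t)) t - linearFeedback A ξ θ (y t) =
      θ * (A / ξ) * Gamma0 ξ (initialState ι) * Real.exp ((ξ - θ) * t) := by
  rw [← (hy.isStatePath hT t ht).1, linearFeedback, sub_sub_cancel,
    hy.Gamma0_eq_mul_exp hA hξ hξ_root ht, ← mul_assoc]

theorem eqOn_of_consumption_eq (hT : 0 ≤ T) (hA : 0 ≤ A) {i j c : ℝ → ℝ}
    (hi : ContinuousOn i (Ici 0)) (hj : ContinuousOn j (Ici 0))
    (hic : ∀ t, 0 ≤ t → A * capital ι i t - i t = c t)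
    (hjc : ∀ t, 0 ≤ t → A * capital ι j t - j t = c t) : EqOn i j (Ici 0) := fun t ht => by
  have h_cont : Continuous fun t => i (max t 0) - j (max t 0) :=
    (hi.sub hj).comp_continuous (by fun_prop) fun s => le_max_right s 0
  have h_zero := eq_zero_of_abs_le_integral (K := A) h_cont (fun t ht => ?_) ht
  · simpa only [max_eq_left (show 0 ≤ t from ht), sub_eq_zero] using h_zero
  have h_int : ∫ s in (0 : ℝ)..t, |i (max s 0) - j (max s 0)| = ∫ s in (0 : ℝ)..t, |i s - j s| := by
    refine intervalIntegral.integral_congr fun s hs => ?_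
    rw [uIcc_of_le ht] at hs
    simp only [max_eq_left hs.1]
  have h_capital := abs_capital_sub_le (ι := ι) hT (.of_continuousOn hi) (.of_continuousOn hj) ht
  calc |i (max t 0) - j (max t 0)| = A * |capital ι i t - capital ι j t| := by
        rw [max_eq_left ht, show i t - j t = A * (capital ι i t - capital ι j t) by
          linarith [hic t ht, hjc t ht], abs_mul, abs_of_nonneg hA]
    _ ≤ A * ∫ s in (0 : ℝ)..t, |i (max s 0) - j (max s 0)| := by rw [h_int]; gcongr

theorem IsClosedLoopSolution.eqOn (hT : 0 ≤ T) (hA : 0 < A) (hξ : ξ ≠ 0)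
    (hξ_root : ξ = A * (1 - Real.exp (-ξ * T))) {y z : ℝ → StateSpace T}
    (hy : IsClosedLoopSolution (linearFeedback A ξ θ) (initialState ι) y)
    (hz : IsClosedLoopSolution (linearFeedback A ξ θ) (initialState ι) z) :
    EqOn y z (Ici 0) := by
  have h_control := eqOn_of_consumption_eq hT hA.le
    ((continuous_linearFeedback A ξ θ).comp_continuousOn hy.1)
    ((continuous_linearFeedback A ξ θ).comp_continuousOn hz.1)
    (fun t ht => hy.consumption_eq hT hA.ne' hξ hξ_root ht)
    (fun t ht => hz.consumption_eq hT hA.ne' hξ hξ_root ht)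
  exact ((hy.isStatePath hT).congr h_control).eqOn (hz.isStatePath hT)

theorem exists_continuous_consumption_eq (hT : 0 ≤ T) (hA : 0 ≤ A) (ι : L2Hist T) {c : ℝ → ℝ}
    {M l : ℝ} (hc : Continuous c) (hcM : ∀ t, 0 ≤ t → |c t| ≤ M * Real.exp (l * t)) :
    ∃ i : ℝ → ℝ, Continuous i ∧ ∀ t, 0 ≤ t → A * capital ι i t - i t = c t := by
  have hM : 0 ≤ M := by simpa using (abs_nonneg _).trans (hcM 0 le_rfl)
  have h_growth (t : ℝ) (ht : 0 ≤ t) : |A * capital ι 0 t - c t| ≤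
      (A * (∫ s in Ioo (-T) 0, |ι s|) + M) * Real.exp (max (A + 1) l * t) := by
    have h_one : 1 ≤ Real.exp (max (A + 1) l * t) :=
      Real.one_le_exp (mul_nonneg (le_max_of_le_left (by positivity)) ht)
    have h_capital := mul_le_mul_of_nonneg_left (abs_capital_zero_le (ι := ι) hT ht) hA
    have h_mono : Real.exp (l * t) ≤ Real.exp (max (A + 1) l * t) := by
      gcongr
      exact le_max_right _ _
    calc |A * capital ι 0 t - c t| ≤ |A * capital ι 0 t| + |c t| := abs_sub _ _
      _ ≤ A * (∫ s in Ioo (-T) 0, |ι s|) + M * Real.exp (l * t) := by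
        rw [abs_mul, abs_of_nonneg hA]
        exact add_le_add h_capital (hcM t ht)
      _ ≤ A * (∫ s in Ioo (-T) 0, |ι s|) * Real.exp (max (A + 1) l * t) +
          M * Real.exp (max (A + 1) l * t) :=
        add_le_add (le_mul_of_one_le_right (by positivity) h_one)
          (mul_le_mul_of_nonneg_left h_mono hM)
      _ = _ := by ring
  have h_lip (i j : ℝ → ℝ) (hi : Continuous i) (hj : Continuous j) (t : ℝ) (ht : 0 ≤ t) :
      |(A * capital ι i t - c t) - (A * capital ι j t - c t)| ≤
        A * ∫ s in (0 : ℝ)..t, |i s - j s| := by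
    rw [sub_sub_sub_cancel_right, ← mul_sub, abs_mul, abs_of_nonneg hA]
    exact mul_le_mul_of_nonneg_left (abs_capital_sub_le hT (.of_continuousOn hi.continuousOn)
      (.of_continuousOn hj.continuousOn) ht) hA
  obtain ⟨i, hi, h_eq⟩ := exists_continuous_eq_of_abs_sub_le_integral
    (F := fun i t => A * capital ι i t - c t) hA ((lt_add_one A).trans_le (le_max_left _ l))
    (fun i hi => (continuousOn_const.mul
      (continuousOn_capital hT (.of_continuousOn hi.continuousOn))).sub hc.continuousOn)
    h_lip h_growth
  exact ⟨i, hi, fun t ht => by rw [h_eq t ht, sub_sub_cancel]⟩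

theorem integral_exp_neg_mul_mul_exp (ξ θ t : ℝ) :
    ∫ s in (0 : ℝ)..t, Real.exp (-ξ * s) * (θ * Real.exp ((ξ - θ) * s)) =
      1 - Real.exp (-ξ * t) * Real.exp ((ξ - θ) * t) := by
  have h_deriv (s : ℝ) : HasDerivAt (fun s => -Real.exp (-θ * s)) (θ * Real.exp (-θ * s)) s := by
    refine ((hasDerivAt_id s).const_mul (-θ)).exp.neg.congr_deriv ?_
    simp only [id]
    ring
  simp only [mul_left_comm _ θ, exp_mul_exp_sub]
  rw [intervalIntegral.integral_eq_sub_of_hasDerivAt (fun s _ => h_deriv s)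
    (Continuous.intervalIntegrable (by fun_prop) _ _), mul_zero, Real.exp_zero]
  ring

theorem exists_isClosedLoopSolution (hT : 0 ≤ T) (hA : 0 < A) (hξ : ξ ≠ 0)
    (hξ_root : ξ = A * (1 - Real.exp (-ξ * T))) (θ : ℝ) (ι : L2Hist T) :
    ∃ y, IsClosedLoopSolution (linearFeedback A ξ θ) (initialState ι) y := by
  set Γ : ℝ → ℝ := fun t => Gamma0 ξ (initialState ι) * Real.exp ((ξ - θ) * t)
  obtain ⟨i, hi, h_consumption⟩ := exists_continuous_consumption_eq
    (c := fun t => θ * (A / ξ) * Γ t)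
    (M := |θ * (A / ξ) * Gamma0 ξ (initialState ι)|) (l := ξ - θ) hT hA.le ι (by fun_prop)
    fun t _ => by simp only [Γ]; rw [← mul_assoc, abs_mul, Real.abs_exp]
  have hi2 : MemL2Loc i := .of_continuousOn hi.continuousOn
  obtain ⟨y, hyc, hy⟩ := exists_isStatePath (ι := ι) hT hi2
  have hΓ (t : ℝ) (ht : 0 ≤ t) : Gamma0 ξ (y t) = Γ t := by
    refine mul_left_cancel₀ (Real.exp_ne_zero (-ξ * t)) ?_
    have h_int : ∫ s in (0 : ℝ)..t, Real.exp (-ξ * s) * (ξ / A * (A * capital ι i s - i s)) =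
        Gamma0 ξ (initialState ι) *
          ∫ s in (0 : ℝ)..t, Real.exp (-ξ * s) * (θ * Real.exp ((ξ - θ) * s)) := by
      rw [← intervalIntegral.integral_const_mul]
      refine intervalIntegral.integral_congr fun s hs => ?_
      rw [uIcc_of_le ht] at hs
      simp only [h_consumption s hs.1, Γ]
      field_simp
    rw [hy.exp_neg_mul_Gamma0 hT hA.ne' hξ_root hi2 hyc ht, h_int, integral_exp_neg_mul_mul_exp]
    ring
  have h_feedback (t : ℝ) (ht : 0 ≤ t) : i t = linearFeedback A ξ θ (y t) := by
    rw [linearFeedback, hΓ t ht, (hy t ht).1, ← h_consumption t ht, sub_sub_cancel]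
  obtain ⟨-, h0, h_eq⟩ := hy.isControlledSolution hT hi2 hyc
  refine ⟨y, hyc, h0, fun ψ t ht => (h_eq ψ t ht).trans ?_⟩
  refine congrArg _ (intervalIntegral.integral_congr fun s hs => ?_)
  rw [uIcc_of_le ht] at hs
  simp only [h_feedback s hs.1]

theorem IsClosedLoopSolution.Gamma0_pos_and_linearFeedback_pos (hT : 0 ≤ T) (hA : 0 < A)
    (hξ : 0 < ξ) (hξ_root : ξ = A * (1 - Real.exp (-ξ * T))) (hθ : 0 ≤ θ) (hθA : θ < A)
    (hι : ∀ᵐ s ∂histMeasure T, 0 ≤ ι s) (hι0 : 0 < ∫ s in Ioo (-T) 0, ι s)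
    {y : ℝ → StateSpace T}
    (hy : IsClosedLoopSolution (linearFeedback A ξ θ) (initialState ι) y) {t : ℝ} (ht : 0 ≤ t) :
    0 < Gamma0 ξ (y t) ∧ 0 < linearFeedback A ξ θ (y t) := by
  have h_state {t : ℝ} (ht : 0 ≤ t) (h : ∀ s ∈ Ico 0 t, 0 ≤ linearFeedback A ξ θ (y s)) :
      IsInvestmentState (y t) :=
    (hy.isStatePath hT).isInvestmentState hT hι hy.memL2Loc ht h
  have h_initial : 0 < Gamma0 ξ (initialState ι) := by
    refine IsInvestmentState.Gamma0_pos ?_ hξ hι0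
    rw [← hy.2.1]
    exact h_state le_rfl (by simp)
  have hΓ {t : ℝ} (ht : 0 ≤ t) : 0 < Gamma0 ξ (y t) := by
    rw [hy.Gamma0_eq_mul_exp hA.ne' hξ.ne' hξ_root ht]
    positivity
  refine ⟨hΓ ht, forall_pos_of_forall_nonneg_before
    ((continuous_linearFeedback A ξ θ).comp_continuousOn hy.1) (fun t ht h => ?_) ht⟩
  exact (h_state ht h).linearFeedback_pos hA hξ hξ_root hθ hθA (hΓ ht)

end ClosedLoop

section Optimality

variable {T A σ ρ ξ θ : ℝ} {ι : L2Hist T}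

/-- The optimal rate of consumption out of equivalent capital: the optimal consumption is
`consumptionRate σ ρ ξ * (A / ξ) * Γ₀`, and `Γ₀` then grows at rate `ξ - consumptionRate σ ρ ξ`. -/
noncomputable def consumptionRate (σ ρ ξ : ℝ) : ℝ := (ρ - ξ * (1 - σ)) / σ

theorem consumptionRate_pos (hσ : 0 < σ) (hρ : ξ * (1 - σ) < ρ) : 0 < consumptionRate σ ρ ξ :=
  div_pos (sub_pos.2 hρ) hσ

theorem mul_sub_consumptionRate (hσ : σ ≠ 0) : σ * (ξ - consumptionRate σ ρ ξ) = ξ - ρ := by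
  rw [consumptionRate, mul_sub, mul_div_cancel₀ _ hσ]
  ring

theorem nu_rpow_mul_rpow (hA : 0 < A) (hξ : 0 < ξ) (hσ : 0 < σ) (hρ : ξ * (1 - σ) < ρ) :
    nu A σ ρ ξ ^ (-1 / σ) * (A / ξ) ^ (1 / σ) = consumptionRate σ ρ ξ * (A / ξ) := by
  have hθ := consumptionRate_pos hσ hρ
  have hAξ : 0 < A / ξ := div_pos hA hξ
  rw [nu, ← consumptionRate, Real.mul_rpow (by positivity) (by positivity),
    ← Real.rpow_mul hθ.le, ← Real.rpow_mul hAξ.le, mul_assoc, ← Real.rpow_add hAξ,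
    show -σ * (-1 / σ) = 1 by field_simp, show (1 - σ) * (-1 / σ) + 1 / σ = 1 by field_simp; ring,
    Real.rpow_one, Real.rpow_one]

theorem feedback_eq_linearFeedback (hA : 0 < A) (hξ : 0 < ξ) (hσ : 0 < σ)
    (hρ : ξ * (1 - σ) < ρ) :
    feedback A σ ρ ξ = linearFeedback (T := T) A ξ (consumptionRate σ ρ ξ) := by
  ext x
  rw [feedback, linearFeedback, nu_rpow_mul_rpow hA hξ hσ hρ]

theorem candidateV_eq (hA : 0 < A) (hξ : 0 < ξ) (hσ : 0 < σ) (hρ : ξ * (1 - σ) < ρ)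
    {x : StateSpace T} (hx : 0 < Gamma0 ξ x) :
    candidateV A σ ρ ξ x = (1 - σ)⁻¹ *
      ((consumptionRate σ ρ ξ * (A / ξ) * Gamma0 ξ x) ^ (1 - σ) / consumptionRate σ ρ ξ) := by
  have hθ := consumptionRate_pos hσ hρ
  rw [candidateV, nu, ← consumptionRate, Real.mul_rpow (by positivity) hx.le,
    Real.mul_rpow hθ.le (by positivity), rpow_one_sub_eq_mul hθ]
  field_simp

theorem mem_setO_iff {x : StateSpace T} :
    x ∈ setO T A σ ρ ξ ↔ 0 < Gamma0 ξ x ∧ 0 < feedback A σ ρ ξ x := by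
  rw [feedback, sub_pos]
  rfl

theorem fst_pos_of_linearFeedback_pos (hA : 0 < A) (hξ : 0 < ξ) (hθ : 0 ≤ θ) {x : StateSpace T}
    (hΓ : 0 ≤ Gamma0 ξ x) (hx : 0 < linearFeedback A ξ θ x) : 0 < x.fst := by
  have h_consumption : 0 ≤ θ * (A / ξ) * Gamma0 ξ x := by positivity
  exact pos_of_mul_pos_right (h_consumption.trans_lt (sub_pos.1 hx)) hA.le

theorem welfare_eq_of_consumption_eq {i c : ℝ → ℝ}
    (h : ∀ t, 0 ≤ t → A * capital ι i t - i t = c t) :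
    welfare A σ ρ ι i =
      powerUtility (volume.restrict (Ioi 0)) (fun t => Real.exp (-ρ * t)) σ c := by
  refine congrArg _ (congrArg _ (setLIntegral_congr_fun measurableSet_Ioi fun t ht => ?_))
  simp only [h t (le_of_lt ht)]

theorem IsOptimal.value_eq {i : ℝ → ℝ} (hi : IsOptimal A σ ρ ι i) :
    value A σ ρ ι = welfare A σ ρ ι i :=
  le_antisymm (iSup₂_le hi.2) (le_iSup₂ (f := fun j _ => welfare A σ ρ ι j) i hi.1)

theorem IsClosedLoopSolution.admissible (hT : 0 ≤ T) (hA : 0 < A) (hξ : 0 < ξ)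
    (hξ_root : ξ = A * (1 - Real.exp (-ξ * T))) (hθ : 0 ≤ θ)
    (hx : 0 ≤ Gamma0 ξ (initialState ι)) {y : ℝ → StateSpace T}
    (hy : IsClosedLoopSolution (linearFeedback A ξ θ) (initialState ι) y)
    (h_nonneg : ∀ t, 0 ≤ t → 0 ≤ linearFeedback A ξ θ (y t)) :
    (fun t => linearFeedback A ξ θ (y t)) ∈ admissible A ι := by
  refine ⟨hy.memL2Loc, fun t ht => ⟨h_nonneg t ht, sub_nonneg.1 ?_⟩⟩
  rw [hy.consumption_eq hT hA.ne' hξ.ne' hξ_root ht]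
  positivity

theorem IsClosedLoopSolution.isOptimal (hT : 0 ≤ T) (hA : 0 < A) (hξ : 0 < ξ)
    (hξ_root : ξ = A * (1 - Real.exp (-ξ * T))) (hσ : 0 ≤ σ) (hσ1 : σ ≠ 1) (hθ : 0 < θ)
    (hσθ : σ * (ξ - θ) = ξ - ρ) (hι : ∀ᵐ s ∂histMeasure T, 0 ≤ ι s)
    (hx : 0 < Gamma0 ξ (initialState ι)) {y : ℝ → StateSpace T}
    (hy : IsClosedLoopSolution (linearFeedback A ξ θ) (initialState ι) y)
    (h_nonneg : ∀ t, 0 ≤ t → 0 ≤ linearFeedback A ξ θ (y t)) :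
    IsOptimal A σ ρ ι (fun t => linearFeedback A ξ θ (y t)) := by
  refine ⟨hy.admissible hT hA hξ hξ_root hθ.le hx.le h_nonneg, fun j hj => ?_⟩
  obtain ⟨h_int, h_budget⟩ :=
    integrableOn_and_integral_consumption_le_of_admissible hT hA hξ hξ_root hι hj
  rw [welfare_eq_of_consumption_eq fun t ht => hy.consumption_eq hT hA.ne' hξ.ne' hξ_root ht]
  refine powerUtility_le_exp_of_budget hσ hσ1 hθ (by positivity) hσθ
    (fun t ht => sub_nonneg.2 (hj.2 t ht).2) h_int (h_budget.trans_eq ?_)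
  field_simp

theorem IsClosedLoopSolution.welfare_eq (hT : 0 ≤ T) (hA : 0 < A) (hξ : 0 < ξ)
    (hξ_root : ξ = A * (1 - Real.exp (-ξ * T))) (hθ : 0 < θ) (hσθ : σ * (ξ - θ) = ξ - ρ)
    (hx : 0 < Gamma0 ξ (initialState ι)) {y : ℝ → StateSpace T}
    (hy : IsClosedLoopSolution (linearFeedback A ξ θ) (initialState ι) y) :
    welfare A σ ρ ι (fun t => linearFeedback A ξ θ (y t)) =
      (((1 - σ)⁻¹ * ((θ * (A / ξ) * Gamma0 ξ (initialState ι)) ^ (1 - σ) / θ) : ℝ) : EReal) := by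
  rw [welfare_eq_of_consumption_eq fun t ht => hy.consumption_eq hT hA.ne' hξ.ne' hξ_root ht]
  exact powerUtility_exp hθ (by positivity) hσθ

end Optimality

end VintageCapital

theorem mainTheorem9 (T A σ ρ ξ : ℝ) (hT : 0 < T) (hσ : 0 < σ) (hσ1 : σ ≠ 1)
    (hAT : 1 < A * T)
    (hξ : 0 < ξ) (hξ_root : ξ = A * (1 - Real.exp (-ξ * T)))
    (hfin : ξ * (1 - σ) < ρ) (hint : (ρ - ξ * (1 - σ)) / σ < A)
    (k₀ : ℝ) (ι : VintageCapital.L2Hist T) (hk₀ : 0 < k₀)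
    (hι : ∀ᵐ s ∂(VintageCapital.histMeasure T), 0 ≤ ι s)
    (hk₀ι : k₀ = ∫ s in Set.Ioo (-T) 0, ι s)
    (x : VintageCapital.StateSpace T) (hx : x = WithLp.toLp 2 (k₀, VintageCapital.histF T ι)) :
    ∃ y : ℝ → VintageCapital.StateSpace T,
      VintageCapital.IsClosedLoopSolution (VintageCapital.feedback A σ ρ ξ) x y ∧
      (∀ z : ℝ → VintageCapital.StateSpace T,
        VintageCapital.IsClosedLoopSolution (VintageCapital.feedback A σ ρ ξ) x z →
          Set.EqOn z y (Set.Ici 0)) ∧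
      (∀ t : ℝ, 0 ≤ t → y t ∈ VintageCapital.setO T A σ ρ ξ ∧ 0 < (y t).fst ∧
        0 < VintageCapital.feedback A σ ρ ξ (y t)) ∧
      VintageCapital.IsOptimal A σ ρ ι (fun t => VintageCapital.feedback A σ ρ ξ (y t)) ∧
      VintageCapital.value A σ ρ ι =
        ((VintageCapital.candidateV A σ ρ ξ x : ℝ) : EReal) := by
  open VintageCapital in
  obtain rfl : x = initialState ι := by rw [hx, hk₀ι, initialState]
  have hA : 0 < A := pos_of_mul_pos_left (one_pos.trans hAT) hT.le
  have hθ : 0 < consumptionRate σ ρ ξ := consumptionRate_pos hσ hfin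
  have hσθ := mul_sub_consumptionRate (ρ := ρ) (ξ := ξ) hσ.ne'
  simp only [mem_setO_iff, feedback_eq_linearFeedback hA hξ hσ hfin]
  obtain ⟨y, hy⟩ := exists_isClosedLoopSolution hT.le hA hξ.ne' hξ_root (consumptionRate σ ρ ξ) ι
  have h_pos (t : ℝ) (ht : 0 ≤ t) :=
    hy.Gamma0_pos_and_linearFeedback_pos hT.le hA hξ hξ_root hθ.le hint hι (hk₀ι ▸ hk₀) ht
  have hΓ : 0 < Gamma0 ξ (initialState ι) := hy.2.1 ▸ (h_pos 0 le_rfl).1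
  have h_opt : IsOptimal A σ ρ ι fun t => linearFeedback A ξ (consumptionRate σ ρ ξ) (y t) :=
    hy.isOptimal hT.le hA hξ hξ_root hσ.le hσ1 hθ hσθ hι hΓ fun t ht => (h_pos t ht).2.le
  refine ⟨y, hy, fun z hz => hz.eqOn hT.le hA hξ.ne' hξ_root hy, fun t ht => ?_, h_opt, ?_⟩
  · obtain ⟨hΓt, h_feedback⟩ := h_pos t ht
    exact ⟨⟨hΓt, h_feedback⟩,
      fst_pos_of_linearFeedback_pos hA hξ hθ.le hΓt.le h_feedback, h_feedback⟩
  · rw [h_opt.value_eq, hy.welfare_eq hT.le hA hξ hξ_root hθ hσθ hΓ,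
      candidateV_eq hA hξ hσ hfin hΓ]
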